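/- Let $D\subset\mathbb R^6$ be an open set of points $(t,x,u,u_x,u_{xx},u_{xxx})$, let $F,G:D\to\mathbb R$ be smooth with $F\neq0$ everywhere on $D$, and let $M\subset\mathbb R^3$ be the projection of $D$ to the coordinates $(t,x,u)$; assume that every slice $\{(t,x,u)\in M: t=t_0\}$ is connected (or empty). Consider the evolution equation $$u_t=F(t,x,u,u_x,u_{xx},u_{xxx})\,u_{xxxx}+G(t,x,u,u_x,u_{xx},u_{xxx}).\qquad(*)$$ Let $\Phi$ be a smooth local one-parameter group of transformations of $M$ with infinitesimal generator $$V=\tau(t,x,u)\partial_t+\xi(t,x,u)\partial_x+\eta(t,x,u)\partial_u .$$ Call $\Phi$ a symmetry group of $(*)$ if its prolongation to fourth-order jets of functions $u(t,x)$ leaves invariant (locally, that is, for all sufficiently small group parameters, depending on the jet) the set of jets satisfying $(*)$. Here a jet is moved by representing it by a smooth function $f$ and moving the graph of $f$. Then $\Phi$ is a symmetry group of $(*)$ if and only if $\tau=\tau(t)$ depends on $t$ only, so that $$V=\tau(t)\partial_t+\xi(t,x,u)\partial_x+\eta(t,x,u)\partial_u ,$$ and $\tau,\xi,\eta$ satisfy,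 at every point of $D$, the two classifying equations $$(4u_x\xi_u+4\xi_x-\dot\tau)F-\tau F_t-\xi F_x-\eta F_u+A_1F_{u_x}+A_2F_{u_{xx}}+A_3F_{u_{xxx}}=0,$$ $$A_4F+(\eta_u-\dot\tau-u_x\xi_u)G-\tau G_t-\xi G_x-\eta G_u+A_1G_{u_x}+A_2G_{u_{xx}}+A_3G_{u_{xxx}}-u_x\xi_t+\eta_t=0,$$ where $\dot\tau=d\tau/dt$ and $$A_1=u_x\xi_x-u_x\eta_u+u_x^2\xi_u-\eta_x,$$ $$A_2=-u_{xx}\eta_u-\eta_{xx}+u_x^3\xi_{uu}-u_x^2\eta_{uu}-2u_x\eta_{xu}+2u_{xx}\xi_x+u_x\xi_{xx}+2u_x^2\xi_{xu}+3u_xu_{xx}\xi_u,$$ $$\begin{aligned}A_3={}&-3u_x^2\eta_{xuu}-\eta_{xxx}+u_x^4\xi_{uuu}-3u_x\eta_{xxu}-3u_{xx}\eta_{xu}+3u_{xxx}\xi_x+3u_{xx}^2\xi_u+3u_{xx}\xi_{xx}+3u_x^3\xi_{xuu}\\&+u_x\xi_{xxx}+6u_x^2u_{xx}\xi_{uu}-u_x^3\eta_{uuu}+9u_xu_{xx}\xi_{xu}-u_{xxx}\eta_u+4u_xu_{xxx}\xi_u+3u_x^2\xi_{xxu}-3u_xu_{xx}\eta_{uu},\end{aligned}$$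 $$\begin{aligned}A_4={}&-12u_xu_{xx}\eta_{xuu}-u_x^4\eta_{uuuu}+u_x\xi_{xxxx}+u_x^5\xi_{uuuu}+4u_x^4\xi_{xuuu}-6u_x^2\eta_{xxuu}+6u_x^3\xi_{xxuu}-4u_{xxx}\eta_{xu}\\&-6u_{xx}\eta_{xxu}-4u_x\eta_{xxxu}+12u_{xx}^2\xi_{xu}-4u_x^3\eta_{xuuu}-3u_{xx}^2\eta_{uu}+4u_x^2\xi_{xxxu}+4u_{xx}\xi_{xxx}+6u_{xxx}\xi_{xx}\\&-\eta_{xxxx}-6u_x^2u_{xx}\eta_{uuu}+16u_xu_{xxx}\xi_{xu}-4u_xu_{xxx}\eta_{uu}+10u_x^2u_{xxx}\xi_{uu}+15u_xu_{xx}^2\xi_{uu}\\&+10u_x^3u_{xx}\xi_{uuu}+10u_{xx}u_{xxx}\xi_u+24u_x^2u_{xx}\xi_{xuu}+18u_xu_{xx}\xi_{xxu}.\end{aligned}$$ -/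

import Mathlib

open scoped ContDiff Topology

namespace FourthOrder

/-- The partial derivative with respect to the `i`-th coordinate. -/
noncomputable def pd {n : ℕ} (i : Fin n) (f : (Fin n → ℝ) → ℝ) : (Fin n → ℝ) → ℝ :=
  fun p => fderiv ℝ f p (Pi.single i 1)

/-- The projection of a jet `(t, x, u, u_x, u_xx, u_xxx)` to its base point `(t, x, u)`. -/
def base (q : Fin 6 → ℝ) : Fin 3 → ℝ := ![q 0, q 1, q 2]

/-! ### The equation `u_t = F u_xxxx + G`

Functions `u = f(t, x)` have the coordinates `0 = t`, `1 = x`. -/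

/-- The point `(t, x, f)` of the graph of `f` over `s = (t, x)`. -/
def graphPt (f : (Fin 2 → ℝ) → ℝ) (s : Fin 2 → ℝ) : Fin 3 → ℝ := ![s 0, s 1, f s]

/-- The jet `(t, x, f, f_x, f_xx, f_xxx)` of `f` at `s = (t, x)`. -/
noncomputable def jet (f : (Fin 2 → ℝ) → ℝ) (s : Fin 2 → ℝ) : Fin 6 → ℝ :=
  ![s 0, s 1, f s, pd 1 f s, pd 1 (pd 1 f) s, pd 1 (pd 1 (pd 1 f)) s]

/-- The fourth-order jet of `f` at `s` lies on the manifold given by `u_t = F u_xxxx + G`, where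
`F` and `G` are functions on the set `D` of jets `(t, x, u, u_x, u_xx, u_xxx)`. -/
def OnEquation (D : Set (Fin 6 → ℝ)) (F G : (Fin 6 → ℝ) → ℝ) (f : (Fin 2 → ℝ) → ℝ)
    (s : Fin 2 → ℝ) : Prop :=
  jet f s ∈ D ∧
    pd 0 f s = F (jet f s) * pd 1 (pd 1 (pd 1 (pd 1 f))) s + G (jet f s)

/-! ### Local one-parameter groups of point transformations -/

/-- A smooth local one-parameter group of transformations of a set `M` of points `(t, x, u)`.
The transformation with parameter `ε` is defined at the points `p` with `(ε, p) ∈ dom`. -/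
structure LocalGroup (M : Set (Fin 3 → ℝ)) where
  /-- the domain of definition -/
  dom : Set (ℝ × (Fin 3 → ℝ))
  /-- the transformations -/
  act : ℝ → (Fin 3 → ℝ) → (Fin 3 → ℝ)
  isOpen_dom : IsOpen dom
  zero_mem : ∀ p ∈ M, ((0 : ℝ), p) ∈ dom
  mem_of_dom : ∀ ε p, (ε, p) ∈ dom → p ∈ M
  act_mem : ∀ ε p, (ε, p) ∈ dom → act ε p ∈ M
  smooth : ContDiffOn ℝ ∞ (fun z : ℝ × (Fin 3 → ℝ) => act z.1 z.2) dom
  act_zero : ∀ p ∈ M, act 0 p = p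
  act_act : ∀ δ ε p, (ε, p) ∈ dom → (δ, act ε p) ∈ dom → (δ + ε, p) ∈ dom →
    act δ (act ε p) = act (δ + ε) p

/-- The vector field `τ ∂_t + ξ ∂_x + η ∂_u` is the infinitesimal generator of `Φ`. -/
def IsGenerator {M : Set (Fin 3 → ℝ)} (Φ : LocalGroup M) (τ ξ η : (Fin 3 → ℝ) → ℝ) : Prop :=
  ∀ p ∈ M, HasDerivAt (fun ε : ℝ => Φ.act ε p) ![τ p, ξ p, η p] 0

/-- The image `(t', x')` of `s = (t, x)` when the graph of `f` is moved by the transformation with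
parameter `ε`. -/
def movedPt {M : Set (Fin 3 → ℝ)} (Φ : LocalGroup M) (ε : ℝ) (f : (Fin 2 → ℝ) → ℝ)
    (s : Fin 2 → ℝ) : Fin 2 → ℝ :=
  ![Φ.act ε (graphPt f s) 0, Φ.act ε (graphPt f s) 1]

/-- `g` is (near the image of `s`) the smooth function whose graph is obtained by moving the graph
of `f` near `s` by the transformation with parameter `ε`. -/
def IsTransform {M : Set (Fin 3 → ℝ)} (Φ : LocalGroup M) (ε : ℝ) (f : (Fin 2 → ℝ) → ℝ)
    (s : Fin 2 → ℝ) (g : (Fin 2 → ℝ) → ℝ) : Prop :=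
  ContDiffAt ℝ ∞ g (movedPt Φ ε f s) ∧
    ∀ᶠ s' in 𝓝 s, g (movedPt Φ ε f s') = Φ.act ε (graphPt f s') 2

/-- `Φ` is a symmetry group of `u_t = F u_xxxx + G`: its prolonged action on fourth-order jets
(a jet being represented by any smooth function `f` having it, and being moved by moving the graph
of `f`) leaves the manifold given by the equation invariant. As the action is only local, this is
required of all sufficiently small parameters, depending on the jet. -/
def IsSymmetryGroup {M : Set (Fin 3 → ℝ)} (D : Set (Fin 6 → ℝ)) (F G : (Fin 6 → ℝ) → ℝ)
    (Φ : LocalGroup M) : Prop :=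
  ∀ (f : (Fin 2 → ℝ) → ℝ) (s : Fin 2 → ℝ), ContDiffAt ℝ ∞ f s → OnEquation D F G f s →
    ∀ᶠ ε in 𝓝 (0 : ℝ), ∀ g : (Fin 2 → ℝ) → ℝ, IsTransform Φ ε f s g →
      OnEquation D F G g (movedPt Φ ε f s)

/-! ### The classifying equations

Functions on points `(t, x, u)` have the coordinates `0 = t`, `1 = x`, `2 = u`; functions on jets
have in addition `3 = u_x`, `4 = u_xx`, `5 = u_xxx`. -/

/-- The coefficient of `F_{u_x}` and of `G_{u_x}`. -/
noncomputable def coeff1 (ξ η : (Fin 3 → ℝ) → ℝ) (q : Fin 6 → ℝ) : ℝ :=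
  let p := base q;
  let u1 := q 3;
  u1 * pd 1 ξ p - u1 * pd 2 η p + u1 ^ 2 * pd 2 ξ p - pd 1 η p

/-- The coefficient of `F_{u_xx}` and of `G_{u_xx}`. -/
noncomputable def coeff2 (ξ η : (Fin 3 → ℝ) → ℝ) (q : Fin 6 → ℝ) : ℝ :=
  let p := base q;
  let u1 := q 3;
  let u2 := q 4;
  -u2 * pd 2 η p - pd 1 (pd 1 η) p + u1 ^ 3 * pd 2 (pd 2 ξ) p - u1 ^ 2 * pd 2 (pd 2 η) p
    - 2 * u1 * pd 1 (pd 2 η) p + 2 * u2 * pd 1 ξ p + u1 * pd 1 (pd 1 ξ) p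
    + 2 * u1 ^ 2 * pd 1 (pd 2 ξ) p + 3 * u1 * u2 * pd 2 ξ p

/-- The coefficient of `F_{u_xxx}` and of `G_{u_xxx}`. -/
noncomputable def coeff3 (ξ η : (Fin 3 → ℝ) → ℝ) (q : Fin 6 → ℝ) : ℝ :=
  let p := base q;
  let u1 := q 3;
  let u2 := q 4;
  let u3 := q 5;
  -3 * u1 ^ 2 * pd 1 (pd 2 (pd 2 η)) p - pd 1 (pd 1 (pd 1 η)) p
    + u1 ^ 4 * pd 2 (pd 2 (pd 2 ξ)) p - 3 * u1 * pd 1 (pd 1 (pd 2 η)) p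
    - 3 * u2 * pd 1 (pd 2 η) p + 3 * u3 * pd 1 ξ p + 3 * u2 ^ 2 * pd 2 ξ p
    + 3 * u2 * pd 1 (pd 1 ξ) p + 3 * u1 ^ 3 * pd 1 (pd 2 (pd 2 ξ)) p
    + u1 * pd 1 (pd 1 (pd 1 ξ)) p + 6 * u1 ^ 2 * u2 * pd 2 (pd 2 ξ) p
    - u1 ^ 3 * pd 2 (pd 2 (pd 2 η)) p + 9 * u1 * u2 * pd 1 (pd 2 ξ) p - u3 * pd 2 η p
    + 4 * u1 * u3 * pd 2 ξ p + 3 * u1 ^ 2 * pd 1 (pd 1 (pd 2 ξ)) p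
    - 3 * u1 * u2 * pd 2 (pd 2 η) p

/-- The coefficient of `F` in the second classifying equation. -/
noncomputable def coeff4 (ξ η : (Fin 3 → ℝ) → ℝ) (q : Fin 6 → ℝ) : ℝ :=
  let p := base q;
  let u1 := q 3;
  let u2 := q 4;
  let u3 := q 5;
  -12 * u1 * u2 * pd 1 (pd 2 (pd 2 η)) p - u1 ^ 4 * pd 2 (pd 2 (pd 2 (pd 2 η))) p
    + u1 * pd 1 (pd 1 (pd 1 (pd 1 ξ))) p + u1 ^ 5 * pd 2 (pd 2 (pd 2 (pd 2 ξ))) p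
    + 4 * u1 ^ 4 * pd 1 (pd 2 (pd 2 (pd 2 ξ))) p - 6 * u1 ^ 2 * pd 1 (pd 1 (pd 2 (pd 2 η))) p
    + 6 * u1 ^ 3 * pd 1 (pd 1 (pd 2 (pd 2 ξ))) p - 4 * u3 * pd 1 (pd 2 η) p
    - 6 * u2 * pd 1 (pd 1 (pd 2 η)) p - 4 * u1 * pd 1 (pd 1 (pd 1 (pd 2 η))) p
    + 12 * u2 ^ 2 * pd 1 (pd 2 ξ) p - 4 * u1 ^ 3 * pd 1 (pd 2 (pd 2 (pd 2 η))) p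
    - 3 * u2 ^ 2 * pd 2 (pd 2 η) p + 4 * u1 ^ 2 * pd 1 (pd 1 (pd 1 (pd 2 ξ))) p
    + 4 * u2 * pd 1 (pd 1 (pd 1 ξ)) p + 6 * u3 * pd 1 (pd 1 ξ) p
    - pd 1 (pd 1 (pd 1 (pd 1 η))) p - 6 * u1 ^ 2 * u2 * pd 2 (pd 2 (pd 2 η)) p
    + 16 * u1 * u3 * pd 1 (pd 2 ξ) p - 4 * u1 * u3 * pd 2 (pd 2 η) p
    + 10 * u1 ^ 2 * u3 * pd 2 (pd 2 ξ) p + 15 * u1 * u2 ^ 2 * pd 2 (pd 2 ξ) p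
    + 10 * u1 ^ 3 * u2 * pd 2 (pd 2 (pd 2 ξ)) p + 10 * u2 * u3 * pd 2 ξ p
    + 24 * u1 ^ 2 * u2 * pd 1 (pd 2 (pd 2 ξ)) p + 18 * u1 * u2 * pd 1 (pd 1 (pd 2 ξ)) p

/-- The first classifying equation at the jet `q`, for `τ = τ(t)`. -/
def Class1 (F : (Fin 6 → ℝ) → ℝ) (τ : ℝ → ℝ) (ξ η : (Fin 3 → ℝ) → ℝ) (q : Fin 6 → ℝ) : Prop :=
  let p := base q;
  let u1 := q 3;
  (4 * pd 2 ξ p * u1 + 4 * pd 1 ξ p - deriv τ (q 0)) * F q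
    - τ (q 0) * pd 0 F q - ξ p * pd 1 F q - η p * pd 2 F q
    + coeff1 ξ η q * pd 3 F q + coeff2 ξ η q * pd 4 F q + coeff3 ξ η q * pd 5 F q = 0

/-- The second classifying equation at the jet `q`, for `τ = τ(t)`. -/
def Class2 (F G : (Fin 6 → ℝ) → ℝ) (τ : ℝ → ℝ) (ξ η : (Fin 3 → ℝ) → ℝ) (q : Fin 6 → ℝ) :
    Prop :=
  let p := base q;
  let u1 := q 3;
  coeff4 ξ η q * F q + (pd 2 η p - deriv τ (q 0) - u1 * pd 2 ξ p) * G q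
    - τ (q 0) * pd 0 G q - ξ p * pd 1 G q - η p * pd 2 G q
    + coeff1 ξ η q * pd 3 G q + coeff2 ξ η q * pd 4 G q + coeff3 ξ η q * pd 5 G q
    - u1 * pd 0 ξ p + pd 0 η p = 0

end FourthOrder

open FourthOrder

namespace FourthOrder

/-! ### Calculus of the partial derivatives `pd` -/

section Calculus

variable {n : ℕ} {i j : Fin n} {Ω : Set (Fin n → ℝ)} {f g f' g' : (Fin n → ℝ) → ℝ}

/-! Moving the graph of `f` by the group gives a family `v(ε, t, x)` that satisfies the
characteristic equation `v_ε = η - τ v_t - ξ v_x` (`FlowChart.isMovedBy`). Differentiating it in `x`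
up to four times, and once in `t`, gives the prolongation formulas. Their top terms `τ v_{tx^k}` and
`ξ v_{x^{k+1}}` cancel along an orbit `(ε, t', x')`, whose velocity is `(1, τ, ξ)`. So the defect `Δ
= v_t - F v_xxxx - G` has along orbits a derivative `defectVel` that depends only on the
fourth-order jet (`hasDerivAt_defect`).

If `τ = τ(t)`, this derivative equals `λ Δ + u_xxxx C₁ + C₂`, where `λ = η_u - τ' - u_x ξ_u` and
`C₁`, `C₂` are the left-hand sides of the classifying equations (`defectVel_eq`).

Sufficiency: if `C₁ = C₂ = 0`, then `Δ` solves the linear equation `Δ' = λ Δ` with `Δ(0) = 0`, so it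
vanishes for small `ε`.

Necessity: invariance makes `defectVel` vanish at every jet on the equation, and polynomials realize
the jets needed. The coordinate `u_txxx` is free there and enters only through `4 F (τ_x + u_x τ_u)
u_txxx`. As `F ≠ 0`, and as `u_x` can be varied in the open set `D`, `τ_x = τ_u = 0`. Connected
slices then give `τ = τ(t)`. Finally `u_xxxx` is free too, so `u_xxxx C₁ + C₂ = 0` splits into the
two classifying equations. -/

lemma contDiffOn_pd {k m : WithTop ℕ∞} (hΩ : IsOpen Ω) (hf : ContDiffOn ℝ m f Ω)
    (hk : k + 1 ≤ m) : ContDiffOn ℝ k (pd i f) Ω :=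
  (hf.fderiv_of_isOpen hΩ hk).clm_apply contDiffOn_const

lemma contDiffOn_pd_infty (hΩ : IsOpen Ω) (hf : ContDiffOn ℝ ∞ f Ω) :
    ContDiffOn ℝ ∞ (pd i f) Ω :=
  contDiffOn_pd hΩ hf le_rfl

lemma pd_comm (hΩ : IsOpen Ω) (hf : ContDiffOn ℝ 2 f Ω) {p : Fin n → ℝ} (hp : p ∈ Ω) :
    pd i (pd j f) p = pd j (pd i f) p := by
  have hfp : ContDiffAt ℝ 2 f p := hf.contDiffAt (hΩ.mem_nhds hp)
  have hsymm : IsSymmSndFDerivAt ℝ f p := hfp.isSymmSndFDerivAt (by simp)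
  have hd : DifferentiableAt ℝ (fderiv ℝ f) p :=
    (hfp.fderiv_right (m := 1) (by norm_num)).differentiableAt (by norm_num)
  have key : ∀ v w : Fin n → ℝ,
      fderiv ℝ (fun q => fderiv ℝ f q v) p w = fderiv ℝ (fderiv ℝ f) p w v := by
    intro v w
    rw [fderiv_clm_apply hd (differentiableAt_const v)]
    simp
  unfold pd
  rw [key, key]
  exact hsymm _ _

lemma pd_comm_infty (hΩ : IsOpen Ω) (hf : ContDiffOn ℝ ∞ f Ω) {p : Fin n → ℝ} (hp : p ∈ Ω) :
    pd i (pd j f) p = pd j (pd i f) p :=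
  pd_comm hΩ (contDiffOn_infty.1 hf 2) hp

lemma pd_congr_of_eventuallyEq {p : Fin n → ℝ} (h : f =ᶠ[𝓝 p] g) : pd i f p = pd i g p := by
  unfold pd
  rw [h.fderiv_eq]

lemma pd_eventuallyEq {p : Fin n → ℝ} (h : f =ᶠ[𝓝 p] g) : pd i f =ᶠ[𝓝 p] pd i g :=
  h.eventuallyEq_nhds.mono fun _ hq => pd_congr_of_eventuallyEq hq

lemma pd_congr_on (hΩ : IsOpen Ω) (h : Set.EqOn f g Ω) : Set.EqOn (pd i f) (pd i g) Ω :=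
  fun _ hp => pd_congr_of_eventuallyEq (h.eventuallyEq_of_mem (hΩ.mem_nhds hp))

/-- On `Ω`, `f` is differentiable with `i`-th partial derivative `f'`. -/
def HasPdOn (i : Fin n) (Ω : Set (Fin n → ℝ)) (f f' : (Fin n → ℝ) → ℝ) : Prop :=
  ∀ p ∈ Ω, DifferentiableAt ℝ f p ∧ pd i f p = f' p

lemma ContDiffOn.hasPdOn {m : WithTop ℕ∞} (hΩ : IsOpen Ω) (hf : ContDiffOn ℝ m f Ω)
    (hm : m ≠ 0) : HasPdOn i Ω f (pd i f) :=
  fun _ hp => ⟨(hf.contDiffAt (hΩ.mem_nhds hp)).differentiableAt hm, rfl⟩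

namespace HasPdOn

lemma congr (h : HasPdOn i Ω f f') (hfg : ∀ p ∈ Ω, f' p = g' p) : HasPdOn i Ω f g' :=
  fun p hp => ⟨(h p hp).1, (h p hp).2.trans (hfg p hp)⟩

lemma congr_fun (hΩ : IsOpen Ω) (h : HasPdOn i Ω f f') (hfg : Set.EqOn g f Ω) :
    HasPdOn i Ω g f' := fun p hp =>
  ⟨(h p hp).1.congr_of_eventuallyEq (hfg.eventuallyEq_of_mem (hΩ.mem_nhds hp)),
    (pd_congr_on hΩ hfg hp).trans (h p hp).2⟩

lemma pd_eq (hΩ : IsOpen Ω) (h : HasPdOn i Ω f f') (hfg : Set.EqOn g f Ω) :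
    Set.EqOn (pd i g) f' Ω :=
  fun p hp => ((h.congr_fun hΩ hfg) p hp).2

lemma const (c : ℝ) : HasPdOn i Ω (fun _ => c) (fun _ => 0) :=
  fun p _ => ⟨differentiableAt_const c, by simp [pd]⟩

lemma coord (j : Fin n) :
    HasPdOn i Ω (fun p => p j) (fun _ => (Pi.single i 1 : Fin n → ℝ) j) := fun p _ =>
  ⟨differentiableAt_apply j p, by
    unfold pd
    rw [(hasFDerivAt_apply j p).fderiv]
    rfl⟩

lemma add (hf : HasPdOn i Ω f f') (hg : HasPdOn i Ω g g') :
    HasPdOn i Ω (fun p => f p + g p) (fun p => f' p + g' p) := fun p hp =>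
  ⟨(hf p hp).1.add (hg p hp).1, by
    dsimp only
    rw [← (hf p hp).2, ← (hg p hp).2]
    unfold pd
    rw [fderiv_fun_add (hf p hp).1 (hg p hp).1]
    rfl⟩

lemma sub (hf : HasPdOn i Ω f f') (hg : HasPdOn i Ω g g') :
    HasPdOn i Ω (fun p => f p - g p) (fun p => f' p - g' p) := fun p hp =>
  ⟨(hf p hp).1.sub (hg p hp).1, by
    dsimp only
    rw [← (hf p hp).2, ← (hg p hp).2]
    unfold pd
    rw [fderiv_fun_sub (hf p hp).1 (hg p hp).1]
    rfl⟩

lemma mul (hf : HasPdOn i Ω f f') (hg : HasPdOn i Ω g g') :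
    HasPdOn i Ω (fun p => f p * g p) (fun p => f' p * g p + f p * g' p) := fun p hp =>
  ⟨(hf p hp).1.mul (hg p hp).1, by
    dsimp only
    rw [← (hf p hp).2, ← (hg p hp).2]
    unfold pd
    rw [fderiv_fun_mul (hf p hp).1 (hg p hp).1]
    simp
    ring⟩

lemma const_mul (c : ℝ) (hf : HasPdOn i Ω f f') :
    HasPdOn i Ω (fun p => c * f p) (fun p => c * f' p) :=
  ((HasPdOn.const c).mul hf).congr fun p _ => by ring

lemma pow (k : ℕ) (hf : HasPdOn i Ω f f') :
    HasPdOn i Ω (fun p => f p ^ (k + 1)) (fun p => (k + 1) * f p ^ k * f' p) := by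
  induction k with
  | zero => simpa using hf
  | succ k ih =>
    have h := (ih.mul hf).congr (g' := fun p => ((k + 1 : ℕ) + 1) * f p ^ (k + 1) * f' p)
      fun p _ => by push_cast; ring
    simpa only [← pow_succ] using h

end HasPdOn

lemma fderiv_eq_sum_pd (f : (Fin n → ℝ) → ℝ) (p v : Fin n → ℝ) :
    fderiv ℝ f p v = ∑ i, v i * pd i f p := by
  conv_lhs => rw [← Finset.univ_sum_single v]
  rw [map_sum]
  refine Finset.sum_congr rfl fun i _ => ?_
  have : (Pi.single i (v i) : Fin n → ℝ) = v i • Pi.single i 1 := by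
    rw [← Pi.single_smul]; simp
  rw [this, map_smul]
  rfl

/-- The chain rule along a curve, in terms of partial derivatives. -/
lemma hasDerivAt_comp_pd {c : ℝ → Fin n → ℝ} {c' : Fin n → ℝ} {e : ℝ}
    (hf : DifferentiableAt ℝ f (c e)) (hc : HasDerivAt c c' e) :
    HasDerivAt (fun e => f (c e)) (∑ i, c' i * pd i f (c e)) e := by
  rw [← fderiv_eq_sum_pd]
  exact hf.hasFDerivAt.comp_hasDerivAt e hc

/-- The chain rule for a partial derivative of a composition. -/
lemma pd_comp {m : ℕ} {H : (Fin m → ℝ) → Fin n → ℝ} {p : Fin m → ℝ} {k : Fin m}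
    (hf : DifferentiableAt ℝ f (H p)) (hH : DifferentiableAt ℝ H p) :
    pd k (fun z => f (H z)) p = ∑ i, pd k (fun z => H z i) p * pd i f (H p) := by
  have h := hf.hasFDerivAt.comp p hH.hasFDerivAt
  have h1 : pd k (fun z => f (H z)) p = fderiv ℝ f (H p) (fderiv ℝ H p (Pi.single k 1)) := by
    unfold pd
    exact congrArg (fun L => L (Pi.single k 1)) h.fderiv
  rw [h1, fderiv_eq_sum_pd]
  refine Finset.sum_congr rfl fun i _ => ?_
  have h2 : HasFDerivAt (fun z => H z i) ((ContinuousLinearMap.proj i).comp (fderiv ℝ H p)) p :=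
    (hasFDerivAt_pi'.1 hH.hasFDerivAt) i
  congr 1
  unfold pd
  rw [h2.fderiv]
  rfl

end Calculus

/-! ### Total derivatives of functions of `(t, x, u)` along `u = v(ε, t, x)` -/

/-- The first total `x`-derivative of `φ(t, x, u)`. -/
noncomputable def total1 (φ : (Fin 3 → ℝ) → ℝ) (p : Fin 3 → ℝ) (a1 : ℝ) : ℝ :=
  pd 1 φ p + pd 2 φ p * a1

/-- The second total `x`-derivative of `φ(t, x, u)`. -/
noncomputable def total2 (φ : (Fin 3 → ℝ) → ℝ) (p : Fin 3 → ℝ) (a1 a2 : ℝ) : ℝ :=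
  pd 1 (pd 1 φ) p + 2 * (pd 1 (pd 2 φ) p * a1) + pd 2 (pd 2 φ) p * a1 ^ 2 + pd 2 φ p * a2

/-- The third total `x`-derivative of `φ(t, x, u)`. -/
noncomputable def total3 (φ : (Fin 3 → ℝ) → ℝ) (p : Fin 3 → ℝ) (a1 a2 a3 : ℝ) : ℝ :=
  pd 1 (pd 1 (pd 1 φ)) p + 3 * (pd 1 (pd 1 (pd 2 φ)) p * a1)
    + 3 * (pd 1 (pd 2 (pd 2 φ)) p * a1 ^ 2) + pd 2 (pd 2 (pd 2 φ)) p * a1 ^ 3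
    + 3 * (pd 1 (pd 2 φ) p * a2) + 3 * (pd 2 (pd 2 φ) p * (a1 * a2)) + pd 2 φ p * a3

/-- The fourth total `x`-derivative of `φ(t, x, u)`. -/
noncomputable def total4 (φ : (Fin 3 → ℝ) → ℝ) (p : Fin 3 → ℝ) (a1 a2 a3 a4 : ℝ) : ℝ :=
  pd 1 (pd 1 (pd 1 (pd 1 φ))) p + 4 * (pd 1 (pd 1 (pd 1 (pd 2 φ))) p * a1)
    + 6 * (pd 1 (pd 1 (pd 2 (pd 2 φ))) p * a1 ^ 2) + 4 * (pd 1 (pd 2 (pd 2 (pd 2 φ))) p * a1 ^ 3)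
    + pd 2 (pd 2 (pd 2 (pd 2 φ))) p * a1 ^ 4
    + 6 * (pd 1 (pd 1 (pd 2 φ)) p * a2) + 12 * (pd 1 (pd 2 (pd 2 φ)) p * (a1 * a2))
    + 6 * (pd 2 (pd 2 (pd 2 φ)) p * (a1 ^ 2 * a2)) + 3 * (pd 2 (pd 2 φ) p * a2 ^ 2)
    + 4 * (pd 1 (pd 2 φ) p * a3) + 4 * (pd 2 (pd 2 φ) p * (a1 * a3)) + pd 2 φ p * a4

/-- The point `(t, x, v)` over `z = (ε, t, x)`. -/
def lift (v : (Fin 3 → ℝ) → ℝ) (z : Fin 3 → ℝ) : Fin 3 → ℝ := ![z 1, z 2, v z]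

/-- The `k`-th `x`-derivative of a function of `(ε, t, x)`. -/
noncomputable def vx (v : (Fin 3 → ℝ) → ℝ) : ℕ → (Fin 3 → ℝ) → ℝ
  | 0 => v
  | k + 1 => pd 2 (vx v k)

/-- The `k`-th `x`-derivative of the `t`-derivative of a function of `(ε, t, x)`. -/
noncomputable def vtx (v : (Fin 3 → ℝ) → ℝ) (k : ℕ) : (Fin 3 → ℝ) → ℝ := pd 1 (vx v k)

section Total

variable {M : Set (Fin 3 → ℝ)} {Ω : Set (Fin 3 → ℝ)} {v : (Fin 3 → ℝ) → ℝ}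
  {φ τ ξ η : (Fin 3 → ℝ) → ℝ}

lemma contDiffOn_vx (hΩ : IsOpen Ω) (m k : ℕ) (hv : ContDiffOn ℝ ((m + k : ℕ) : WithTop ℕ∞) v Ω) :
    ContDiffOn ℝ (m : WithTop ℕ∞) (vx v k) Ω := by
  induction k generalizing m with
  | zero => exact hv
  | succ k ih =>
    have h := ih (m + 1) (by rwa [show m + 1 + k = m + (k + 1) by ring])
    exact contDiffOn_pd hΩ h (by push_cast; exact le_rfl)

lemma contDiffOn_vx_of_le (hΩ : IsOpen Ω) (hv : ContDiffOn ℝ 6 v Ω) {m k : ℕ} (h : m + k ≤ 6) :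
    ContDiffOn ℝ (m : WithTop ℕ∞) (vx v k) Ω :=
  contDiffOn_vx hΩ m k (hv.of_le (by exact_mod_cast h))

lemma hasPdOn_vx (hΩ : IsOpen Ω) (hv : ContDiffOn ℝ 6 v Ω) {k : ℕ} (hk : k ≤ 5) (i : Fin 3) :
    HasPdOn i Ω (vx v k) (pd i (vx v k)) :=
  ContDiffOn.hasPdOn hΩ (contDiffOn_vx_of_le hΩ hv (m := 1) (by omega)) (by norm_num)

lemma hasPdOn_vtx (hΩ : IsOpen Ω) (hv : ContDiffOn ℝ 6 v Ω) {k : ℕ} (hk : k ≤ 4) :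
    HasPdOn 2 Ω (vtx v k) (vtx v (k + 1)) := by
  have h2 : ContDiffOn ℝ (2 : ℕ) (vx v k) Ω := contDiffOn_vx_of_le hΩ hv (by omega)
  have h1 : ContDiffOn ℝ 1 (vtx v k) Ω := contDiffOn_pd hΩ h2 (by norm_num)
  exact (ContDiffOn.hasPdOn hΩ h1 (by norm_num)).congr fun z hz => pd_comm hΩ h2 hz

lemma differentiableAt_lift {z : Fin 3 → ℝ} (hv : DifferentiableAt ℝ v z) :
    DifferentiableAt ℝ (lift v) z := by
  rw [differentiableAt_pi]
  intro i
  fin_cases i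
  · exact differentiableAt_apply 1 z
  · exact differentiableAt_apply 2 z
  · exact hv

/-- Chain rule for `φ(t, x, v)`. The variables `t`, `x` are coordinates 1, 2 of `z` but 0, 1 of the
base point, whence the shifted Kronecker factors. -/
lemma hasPdOn_comp_lift (hM : IsOpen M) (hφ : ContDiffOn ℝ ∞ φ M)
    (hv : ∀ z ∈ Ω, DifferentiableAt ℝ v z) (hH : ∀ z ∈ Ω, lift v z ∈ M) (k : Fin 3) :
    HasPdOn k Ω (fun z => φ (lift v z)) (fun z =>
      (Pi.single k 1 : Fin 3 → ℝ) 1 * pd 0 φ (lift v z)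
        + (Pi.single k 1 : Fin 3 → ℝ) 2 * pd 1 φ (lift v z)
        + pd k v z * pd 2 φ (lift v z)) := by
  intro z hz
  have hφz : DifferentiableAt ℝ φ (lift v z) :=
    (hφ.contDiffAt (hM.mem_nhds (hH z hz))).differentiableAt (by simp)
  have hL := differentiableAt_lift (hv z hz)
  refine ⟨hφz.comp z hL, ?_⟩
  rw [pd_comp hφz hL, Fin.sum_univ_three]
  have h1 := ((HasPdOn.coord (i := k) (Ω := Set.univ) (1 : Fin 3)) z trivial).2
  have h2 := ((HasPdOn.coord (i := k) (Ω := Set.univ) (2 : Fin 3)) z trivial).2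
  simp only at h1 h2
  rw [← h1, ← h2]
  rfl

lemma hasPdOn_two_comp_lift (hM : IsOpen M) (hφ : ContDiffOn ℝ ∞ φ M)
    (hv : ∀ z ∈ Ω, DifferentiableAt ℝ v z) (hH : ∀ z ∈ Ω, lift v z ∈ M) :
    HasPdOn 2 Ω (fun z => φ (lift v z)) (fun z => total1 φ (lift v z) (vx v 1 z)) :=
  (hasPdOn_comp_lift hM hφ hv hH 2).congr fun z _ => by
    simp [total1, vx]
    ring

/-- Termwise product and chain rule. Mixed partials are then brought to the normal form with every
`pd 1` outside every `pd 2`, in which the coefficients of the theorem are written. The next two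
orders work in the same way. -/
lemma hasPdOn_total1 (hM : IsOpen M) (hφ : ContDiffOn ℝ ∞ φ M) (hΩ : IsOpen Ω)
    (hv : ContDiffOn ℝ 6 v Ω) (hH : ∀ z ∈ Ω, lift v z ∈ M) :
    HasPdOn 2 Ω (fun z => total1 φ (lift v z) (vx v 1 z))
      (fun z => total2 φ (lift v z) (vx v 1 z) (vx v 2 z)) := by
  have C : ∀ ψ, ContDiffOn ℝ ∞ ψ M →
      HasPdOn 2 Ω (fun z => ψ (lift v z)) (fun z => total1 ψ (lift v z) (vx v 1 z)) := fun ψ hψ =>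
    hasPdOn_two_comp_lift hM hψ (fun z hz => (hasPdOn_vx hΩ hv (k := 0) (by omega) 0 z hz).1) hH
  have V1 : HasPdOn 2 Ω (vx v 1) (vx v 2) := hasPdOn_vx hΩ hv (by omega) 2
  have S : ∀ {ψ} (i : Fin 3), ContDiffOn ℝ ∞ ψ M → ContDiffOn ℝ ∞ (pd i ψ) M := fun i hψ =>
    contDiffOn_pd_infty hM hψ
  have K : ∀ {ψ}, ContDiffOn ℝ ∞ ψ M → Set.EqOn (pd 2 (pd 1 ψ)) (pd 1 (pd 2 ψ)) M :=
    fun hψ p hp => pd_comm_infty hM hψ hp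
  refine ((C _ (S 1 hφ)).add ((C _ (S 2 hφ)).mul V1)).congr fun z hz => ?_
  have := K hφ (hH z hz)
  simp only [total1, total2, this]
  ring

lemma hasPdOn_total2 (hM : IsOpen M) (hφ : ContDiffOn ℝ ∞ φ M) (hΩ : IsOpen Ω)
    (hv : ContDiffOn ℝ 6 v Ω) (hH : ∀ z ∈ Ω, lift v z ∈ M) :
    HasPdOn 2 Ω (fun z => total2 φ (lift v z) (vx v 1 z) (vx v 2 z))
      (fun z => total3 φ (lift v z) (vx v 1 z) (vx v 2 z) (vx v 3 z)) := by
  have C : ∀ ψ, ContDiffOn ℝ ∞ ψ M →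
      HasPdOn 2 Ω (fun z => ψ (lift v z)) (fun z => total1 ψ (lift v z) (vx v 1 z)) := fun ψ hψ =>
    hasPdOn_two_comp_lift hM hψ (fun z hz => (hasPdOn_vx hΩ hv (k := 0) (by omega) 0 z hz).1) hH
  have V1 : HasPdOn 2 Ω (vx v 1) (vx v 2) := hasPdOn_vx hΩ hv (by omega) 2
  have V2 : HasPdOn 2 Ω (vx v 2) (vx v 3) := hasPdOn_vx hΩ hv (by omega) 2
  have S : ∀ {ψ} (i : Fin 3), ContDiffOn ℝ ∞ ψ M → ContDiffOn ℝ ∞ (pd i ψ) M := fun i hψ =>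
    contDiffOn_pd_infty hM hψ
  have K : ∀ {ψ}, ContDiffOn ℝ ∞ ψ M → Set.EqOn (pd 2 (pd 1 ψ)) (pd 1 (pd 2 ψ)) M :=
    fun hψ p hp => pd_comm_infty hM hψ hp
  refine ((((C _ (S 1 (S 1 hφ))).add (((C _ (S 1 (S 2 hφ))).mul V1).const_mul 2)).add
    ((C _ (S 2 (S 2 hφ))).mul (V1.pow 1))).add ((C _ (S 2 hφ)).mul V2)).congr fun z hz => ?_
  have h1 := K (S 2 hφ) (hH z hz)
  have h2 : pd 2 (pd 1 (pd 1 φ)) (lift v z) = pd 1 (pd 1 (pd 2 φ)) (lift v z) :=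
    (K (S 1 hφ) (hH z hz)).trans (pd_congr_on hM (K hφ) (hH z hz))
  simp only [total1, total3, h1, h2]
  push_cast
  ring

lemma hasPdOn_total3 (hM : IsOpen M) (hφ : ContDiffOn ℝ ∞ φ M) (hΩ : IsOpen Ω)
    (hv : ContDiffOn ℝ 6 v Ω) (hH : ∀ z ∈ Ω, lift v z ∈ M) :
    HasPdOn 2 Ω (fun z => total3 φ (lift v z) (vx v 1 z) (vx v 2 z) (vx v 3 z))
      (fun z => total4 φ (lift v z) (vx v 1 z) (vx v 2 z) (vx v 3 z) (vx v 4 z)) := by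
  have C : ∀ ψ, ContDiffOn ℝ ∞ ψ M →
      HasPdOn 2 Ω (fun z => ψ (lift v z)) (fun z => total1 ψ (lift v z) (vx v 1 z)) := fun ψ hψ =>
    hasPdOn_two_comp_lift hM hψ (fun z hz => (hasPdOn_vx hΩ hv (k := 0) (by omega) 0 z hz).1) hH
  have V1 : HasPdOn 2 Ω (vx v 1) (vx v 2) := hasPdOn_vx hΩ hv (by omega) 2
  have V2 : HasPdOn 2 Ω (vx v 2) (vx v 3) := hasPdOn_vx hΩ hv (by omega) 2
  have V3 : HasPdOn 2 Ω (vx v 3) (vx v 4) := hasPdOn_vx hΩ hv (by omega) 2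
  have S : ∀ {ψ} (i : Fin 3), ContDiffOn ℝ ∞ ψ M → ContDiffOn ℝ ∞ (pd i ψ) M := fun i hψ =>
    contDiffOn_pd_infty hM hψ
  have K : ∀ {ψ}, ContDiffOn ℝ ∞ ψ M → Set.EqOn (pd 2 (pd 1 ψ)) (pd 1 (pd 2 ψ)) M :=
    fun hψ p hp => pd_comm_infty hM hψ hp
  have K2 : ∀ {ψ}, ContDiffOn ℝ ∞ ψ M → Set.EqOn (pd 2 (pd 1 (pd 1 ψ))) (pd 1 (pd 1 (pd 2 ψ))) M :=
    fun hψ p hp => (K (S 1 hψ) hp).trans (pd_congr_on hM (K hψ) hp)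
  refine (((((((C _ (S 1 (S 1 (S 1 hφ)))).add
    (((C _ (S 1 (S 1 (S 2 hφ)))).mul V1).const_mul 3)).add
    (((C _ (S 1 (S 2 (S 2 hφ)))).mul (V1.pow 1)).const_mul 3)).add
    ((C _ (S 2 (S 2 (S 2 hφ)))).mul (V1.pow 2))).add
    (((C _ (S 1 (S 2 hφ))).mul V2).const_mul 3)).add
    (((C _ (S 2 (S 2 hφ))).mul (V1.mul V2)).const_mul 3)).add
    ((C _ (S 2 hφ)).mul V3)).congr fun z hz => ?_
  have hz' := hH z hz
  have h1 := K (S 2 hφ) hz'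
  have h2 := K2 (S 2 hφ) hz'
  have h3 := K (S 2 (S 2 hφ)) hz'
  have h4 : pd 2 (pd 1 (pd 1 (pd 1 φ))) (lift v z) = pd 1 (pd 1 (pd 1 (pd 2 φ))) (lift v z) :=
    (K (S 1 (S 1 hφ)) hz').trans (pd_congr_on hM (K2 hφ) hz')
  simp only [total1, total4, h1, h2, h3, h4]
  push_cast
  ring

end Total

/-! ### Prolongation of the characteristic equation `v_ε = η - τ v_t - ξ v_x` -/

section Prolongation

variable {M : Set (Fin 3 → ℝ)} {Ω : Set (Fin 3 → ℝ)} {v τ ξ η : (Fin 3 → ℝ) → ℝ}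

/-- `v(ε, t, x)` is, on `Ω`, a one-parameter family of functions whose graphs in `M` are moved by
the vector field `τ ∂_t + ξ ∂_x + η ∂_u`. -/
structure IsMovedBy (M Ω : Set (Fin 3 → ℝ)) (τ ξ η v : (Fin 3 → ℝ) → ℝ) : Prop where
  isOpen_base : IsOpen M
  isOpen_dom : IsOpen Ω
  smooth_tau : ContDiffOn ℝ ∞ τ M
  smooth_xi : ContDiffOn ℝ ∞ ξ M
  smooth_eta : ContDiffOn ℝ ∞ η M
  smooth : ContDiffOn ℝ 6 v Ω
  lift_mem : ∀ z ∈ Ω, lift v z ∈ M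
  pde : ∀ z ∈ Ω, pd 0 v z = η (lift v z) - τ (lift v z) * vtx v 0 z - ξ (lift v z) * vx v 1 z

lemma hasDerivAt_comp_curve {c : ℝ → Fin 3 → ℝ} {e a b : ℝ} (hc : HasDerivAt c ![1, a, b] e)
    {w : (Fin 3 → ℝ) → ℝ} (hw : DifferentiableAt ℝ w (c e)) :
    HasDerivAt (fun e => w (c e)) (pd 0 w (c e) + a * pd 1 w (c e) + b * pd 2 w (c e)) e := by
  have := hasDerivAt_comp_pd hw hc
  rw [Fin.sum_univ_three] at this
  simpa using this

namespace IsMovedBy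

variable (h : IsMovedBy M Ω τ ξ η v)
include h

/-- Since `∂_ε` and `∂_x` commute, a formula for `∂_ε v_{x^k}` on the open set `Ω` may be
differentiated in `x`. This is the inductive step of the prolongation. -/
lemma pd_zero_vx_succ {k : ℕ} (hk : k ≤ 4) {Q Q' : (Fin 3 → ℝ) → ℝ}
    (hQ : Set.EqOn (pd 0 (vx v k)) Q Ω) (hQ' : HasPdOn 2 Ω Q Q') :
    Set.EqOn (pd 0 (vx v (k + 1))) Q' Ω := fun z hz =>
  (pd_comm h.isOpen_dom
    (contDiffOn_vx_of_le h.isOpen_dom h.smooth (m := 2) (k := k) (by omega)) hz).trans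
    (hQ'.pd_eq h.isOpen_dom hQ hz)

lemma hasPdOn_comp {φ : (Fin 3 → ℝ) → ℝ} (hφ : ContDiffOn ℝ ∞ φ M) :
    HasPdOn 2 Ω (fun z => φ (lift v z)) (fun z => total1 φ (lift v z) (vx v 1 z)) :=
  hasPdOn_two_comp_lift h.isOpen_base hφ
    (fun z hz => (hasPdOn_vx h.isOpen_dom h.smooth (k := 0) (by omega) 0 z hz).1) h.lift_mem

/-- The characteristic equation differentiated by Leibniz' rule, which produces binomial
coefficients at higher orders. The last term of each parenthesis is a transport term, kept apart
because it cancels along orbits. -/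
lemma pd_zero_vx_one : Set.EqOn (pd 0 (vx v 1)) (fun z =>
    total1 η (lift v z) (vx v 1 z)
    - (total1 τ (lift v z) (vx v 1 z) * vtx v 0 z + τ (lift v z) * vtx v 1 z)
    - (total1 ξ (lift v z) (vx v 1 z) * vx v 1 z + ξ (lift v z) * vx v 2 z)) Ω :=
  h.pd_zero_vx_succ (k := 0) (by omega) h.pde
    (((h.hasPdOn_comp h.smooth_eta).sub ((h.hasPdOn_comp h.smooth_tau).mul
      (hasPdOn_vtx h.isOpen_dom h.smooth (by omega)))).sub ((h.hasPdOn_comp h.smooth_xi).mul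
      (hasPdOn_vx h.isOpen_dom h.smooth (by omega) 2)))

lemma hasPdOn_comp1 {φ : (Fin 3 → ℝ) → ℝ} (hφ : ContDiffOn ℝ ∞ φ M) :
    HasPdOn 2 Ω (fun z => total1 φ (lift v z) (vx v 1 z))
      (fun z => total2 φ (lift v z) (vx v 1 z) (vx v 2 z)) :=
  hasPdOn_total1 h.isOpen_base hφ h.isOpen_dom h.smooth h.lift_mem

lemma hasPdOn_comp2 {φ : (Fin 3 → ℝ) → ℝ} (hφ : ContDiffOn ℝ ∞ φ M) :
    HasPdOn 2 Ω (fun z => total2 φ (lift v z) (vx v 1 z) (vx v 2 z))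
      (fun z => total3 φ (lift v z) (vx v 1 z) (vx v 2 z) (vx v 3 z)) :=
  hasPdOn_total2 h.isOpen_base hφ h.isOpen_dom h.smooth h.lift_mem

lemma hasPdOn_comp3 {φ : (Fin 3 → ℝ) → ℝ} (hφ : ContDiffOn ℝ ∞ φ M) :
    HasPdOn 2 Ω (fun z => total3 φ (lift v z) (vx v 1 z) (vx v 2 z) (vx v 3 z))
      (fun z => total4 φ (lift v z) (vx v 1 z) (vx v 2 z) (vx v 3 z) (vx v 4 z)) :=
  hasPdOn_total3 h.isOpen_base hφ h.isOpen_dom h.smooth h.lift_mem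

lemma pd_zero_vx_two : Set.EqOn (pd 0 (vx v 2)) (fun z =>
    total2 η (lift v z) (vx v 1 z) (vx v 2 z)
    - (total2 τ (lift v z) (vx v 1 z) (vx v 2 z) * vtx v 0 z
      + 2 * (total1 τ (lift v z) (vx v 1 z) * vtx v 1 z) + τ (lift v z) * vtx v 2 z)
    - (total2 ξ (lift v z) (vx v 1 z) (vx v 2 z) * vx v 1 z
      + 2 * (total1 ξ (lift v z) (vx v 1 z) * vx v 2 z) + ξ (lift v z) * vx v 3 z)) Ω := by
  have T : ∀ k ≤ 4, HasPdOn 2 Ω (vtx v k) (vtx v (k + 1)) := fun k hk =>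
    hasPdOn_vtx h.isOpen_dom h.smooth hk
  have X : ∀ k ≤ 4, HasPdOn 2 Ω (vx v k) (vx v (k + 1)) := fun k hk =>
    hasPdOn_vx h.isOpen_dom h.smooth (by omega) 2
  refine h.pd_zero_vx_succ (k := 1) (by omega) h.pd_zero_vx_one
    ((((h.hasPdOn_comp1 h.smooth_eta).sub
      (((h.hasPdOn_comp1 h.smooth_tau).mul (T 0 (by omega))).add
        ((h.hasPdOn_comp h.smooth_tau).mul (T 1 (by omega))))).sub
      (((h.hasPdOn_comp1 h.smooth_xi).mul (X 1 (by omega))).add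
        ((h.hasPdOn_comp h.smooth_xi).mul (X 2 (by omega))))).congr fun z _ => ?_)
  ring

lemma pd_zero_vx_three : Set.EqOn (pd 0 (vx v 3)) (fun z =>
    total3 η (lift v z) (vx v 1 z) (vx v 2 z) (vx v 3 z)
    - (total3 τ (lift v z) (vx v 1 z) (vx v 2 z) (vx v 3 z) * vtx v 0 z
      + 3 * (total2 τ (lift v z) (vx v 1 z) (vx v 2 z) * vtx v 1 z)
      + 3 * (total1 τ (lift v z) (vx v 1 z) * vtx v 2 z) + τ (lift v z) * vtx v 3 z)
    - (total3 ξ (lift v z) (vx v 1 z) (vx v 2 z) (vx v 3 z) * vx v 1 z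
      + 3 * (total2 ξ (lift v z) (vx v 1 z) (vx v 2 z) * vx v 2 z)
      + 3 * (total1 ξ (lift v z) (vx v 1 z) * vx v 3 z) + ξ (lift v z) * vx v 4 z)) Ω := by
  have T : ∀ k ≤ 4, HasPdOn 2 Ω (vtx v k) (vtx v (k + 1)) := fun k hk =>
    hasPdOn_vtx h.isOpen_dom h.smooth hk
  have X : ∀ k ≤ 4, HasPdOn 2 Ω (vx v k) (vx v (k + 1)) := fun k hk =>
    hasPdOn_vx h.isOpen_dom h.smooth (by omega) 2
  refine h.pd_zero_vx_succ (k := 2) (by omega) h.pd_zero_vx_two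
    ((((h.hasPdOn_comp2 h.smooth_eta).sub
      ((((h.hasPdOn_comp2 h.smooth_tau).mul (T 0 (by omega))).add
        (((h.hasPdOn_comp1 h.smooth_tau).mul (T 1 (by omega))).const_mul 2)).add
        ((h.hasPdOn_comp h.smooth_tau).mul (T 2 (by omega))))).sub
      ((((h.hasPdOn_comp2 h.smooth_xi).mul (X 1 (by omega))).add
        (((h.hasPdOn_comp1 h.smooth_xi).mul (X 2 (by omega))).const_mul 2)).add
        ((h.hasPdOn_comp h.smooth_xi).mul (X 3 (by omega))))).congr fun z _ => ?_)
  ring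

lemma pd_zero_vx_four : Set.EqOn (pd 0 (vx v 4)) (fun z =>
    total4 η (lift v z) (vx v 1 z) (vx v 2 z) (vx v 3 z) (vx v 4 z)
    - (total4 τ (lift v z) (vx v 1 z) (vx v 2 z) (vx v 3 z) (vx v 4 z) * vtx v 0 z
      + 4 * (total3 τ (lift v z) (vx v 1 z) (vx v 2 z) (vx v 3 z) * vtx v 1 z)
      + 6 * (total2 τ (lift v z) (vx v 1 z) (vx v 2 z) * vtx v 2 z)
      + 4 * (total1 τ (lift v z) (vx v 1 z) * vtx v 3 z) + τ (lift v z) * vtx v 4 z)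
    - (total4 ξ (lift v z) (vx v 1 z) (vx v 2 z) (vx v 3 z) (vx v 4 z) * vx v 1 z
      + 4 * (total3 ξ (lift v z) (vx v 1 z) (vx v 2 z) (vx v 3 z) * vx v 2 z)
      + 6 * (total2 ξ (lift v z) (vx v 1 z) (vx v 2 z) * vx v 3 z)
      + 4 * (total1 ξ (lift v z) (vx v 1 z) * vx v 4 z) + ξ (lift v z) * vx v 5 z)) Ω := by
  have T : ∀ k ≤ 4, HasPdOn 2 Ω (vtx v k) (vtx v (k + 1)) := fun k hk =>
    hasPdOn_vtx h.isOpen_dom h.smooth hk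
  have X : ∀ k ≤ 4, HasPdOn 2 Ω (vx v k) (vx v (k + 1)) := fun k hk =>
    hasPdOn_vx h.isOpen_dom h.smooth (by omega) 2
  refine h.pd_zero_vx_succ (k := 3) (by omega) h.pd_zero_vx_three
    ((((h.hasPdOn_comp3 h.smooth_eta).sub
      (((((h.hasPdOn_comp3 h.smooth_tau).mul (T 0 (by omega))).add
        (((h.hasPdOn_comp2 h.smooth_tau).mul (T 1 (by omega))).const_mul 3)).add
        (((h.hasPdOn_comp1 h.smooth_tau).mul (T 2 (by omega))).const_mul 3)).add
        ((h.hasPdOn_comp h.smooth_tau).mul (T 3 (by omega))))).sub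
      (((((h.hasPdOn_comp3 h.smooth_xi).mul (X 1 (by omega))).add
        (((h.hasPdOn_comp2 h.smooth_xi).mul (X 2 (by omega))).const_mul 3)).add
        (((h.hasPdOn_comp1 h.smooth_xi).mul (X 3 (by omega))).const_mul 3)).add
        ((h.hasPdOn_comp h.smooth_xi).mul (X 4 (by omega))))).congr fun z _ => ?_)
  ring

lemma pd_zero_vtx_zero : Set.EqOn (pd 0 (vtx v 0)) (fun z =>
    (pd 0 η (lift v z) + pd 2 η (lift v z) * vtx v 0 z)
    - ((pd 0 τ (lift v z) + pd 2 τ (lift v z) * vtx v 0 z) * vtx v 0 z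
      + τ (lift v z) * pd 1 (vtx v 0) z)
    - ((pd 0 ξ (lift v z) + pd 2 ξ (lift v z) * vtx v 0 z) * vx v 1 z
      + ξ (lift v z) * vtx v 1 z)) Ω := by
  have h6 := h.smooth
  have hΩ := h.isOpen_dom
  have C : ∀ {ψ}, ContDiffOn ℝ ∞ ψ M → HasPdOn 1 Ω (fun z => ψ (lift v z))
      (fun z => pd 0 ψ (lift v z) + pd 2 ψ (lift v z) * vtx v 0 z) := fun hψ =>
    (hasPdOn_comp_lift h.isOpen_base hψ
      (fun z hz => (hasPdOn_vx hΩ h6 (k := 0) (by omega) 0 z hz).1) h.lift_mem 1).congr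
      fun z _ => by simp [vtx, vx]; ring
  have h2 : ContDiffOn ℝ 2 v Ω := h6.of_le (by norm_num)
  have T : HasPdOn 1 Ω (vtx v 0) (pd 1 (vtx v 0)) :=
    ContDiffOn.hasPdOn hΩ (contDiffOn_pd (k := 1) hΩ h2 (by norm_num)) (by norm_num)
  have X : HasPdOn 1 Ω (vx v 1) (vtx v 1) := hasPdOn_vx hΩ h6 (by omega) 1
  intro z hz
  refine (pd_comm hΩ h2 hz).trans ((((C h.smooth_eta).sub ((C h.smooth_tau).mul T)).sub
    ((C h.smooth_xi).mul X)).pd_eq hΩ h.pde hz)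

end IsMovedBy

end Prolongation

/-! ### The prolonged vector field and the defect of the equation -/

/-- The `∂_{u_x}`-component of the prolonged vector field. -/
noncomputable def prol1 (τ ξ η v : (Fin 3 → ℝ) → ℝ) (z : Fin 3 → ℝ) : ℝ :=
  total1 η (lift v z) (vx v 1 z) - total1 τ (lift v z) (vx v 1 z) * vtx v 0 z
    - total1 ξ (lift v z) (vx v 1 z) * vx v 1 z

/-- The `∂_{u_xx}`-component of the prolonged vector field. -/
noncomputable def prol2 (τ ξ η v : (Fin 3 → ℝ) → ℝ) (z : Fin 3 → ℝ) : ℝ :=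
  total2 η (lift v z) (vx v 1 z) (vx v 2 z)
    - (total2 τ (lift v z) (vx v 1 z) (vx v 2 z) * vtx v 0 z
      + 2 * (total1 τ (lift v z) (vx v 1 z) * vtx v 1 z))
    - (total2 ξ (lift v z) (vx v 1 z) (vx v 2 z) * vx v 1 z
      + 2 * (total1 ξ (lift v z) (vx v 1 z) * vx v 2 z))

/-- The `∂_{u_xxx}`-component of the prolonged vector field. -/
noncomputable def prol3 (τ ξ η v : (Fin 3 → ℝ) → ℝ) (z : Fin 3 → ℝ) : ℝ :=
  total3 η (lift v z) (vx v 1 z) (vx v 2 z) (vx v 3 z)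
    - (total3 τ (lift v z) (vx v 1 z) (vx v 2 z) (vx v 3 z) * vtx v 0 z
      + 3 * (total2 τ (lift v z) (vx v 1 z) (vx v 2 z) * vtx v 1 z)
      + 3 * (total1 τ (lift v z) (vx v 1 z) * vtx v 2 z))
    - (total3 ξ (lift v z) (vx v 1 z) (vx v 2 z) (vx v 3 z) * vx v 1 z
      + 3 * (total2 ξ (lift v z) (vx v 1 z) (vx v 2 z) * vx v 2 z)
      + 3 * (total1 ξ (lift v z) (vx v 1 z) * vx v 3 z))

/-- The `∂_{u_xxxx}`-component of the prolonged vector field. -/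
noncomputable def prol4 (τ ξ η v : (Fin 3 → ℝ) → ℝ) (z : Fin 3 → ℝ) : ℝ :=
  total4 η (lift v z) (vx v 1 z) (vx v 2 z) (vx v 3 z) (vx v 4 z)
    - (total4 τ (lift v z) (vx v 1 z) (vx v 2 z) (vx v 3 z) (vx v 4 z) * vtx v 0 z
      + 4 * (total3 τ (lift v z) (vx v 1 z) (vx v 2 z) (vx v 3 z) * vtx v 1 z)
      + 6 * (total2 τ (lift v z) (vx v 1 z) (vx v 2 z) * vtx v 2 z)
      + 4 * (total1 τ (lift v z) (vx v 1 z) * vtx v 3 z))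
    - (total4 ξ (lift v z) (vx v 1 z) (vx v 2 z) (vx v 3 z) (vx v 4 z) * vx v 1 z
      + 4 * (total3 ξ (lift v z) (vx v 1 z) (vx v 2 z) (vx v 3 z) * vx v 2 z)
      + 6 * (total2 ξ (lift v z) (vx v 1 z) (vx v 2 z) * vx v 3 z)
      + 4 * (total1 ξ (lift v z) (vx v 1 z) * vx v 4 z))

/-- The `∂_{u_t}`-component of the prolonged vector field. -/
noncomputable def prolT (τ ξ η v : (Fin 3 → ℝ) → ℝ) (z : Fin 3 → ℝ) : ℝ :=
  (pd 0 η (lift v z) + pd 2 η (lift v z) * vtx v 0 z)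
    - (pd 0 τ (lift v z) + pd 2 τ (lift v z) * vtx v 0 z) * vtx v 0 z
    - (pd 0 ξ (lift v z) + pd 2 ξ (lift v z) * vtx v 0 z) * vx v 1 z

/-- The jet `(t, x, v, v_x, v_xx, v_xxx)` at `z = (ε, t, x)`. -/
noncomputable def vjet (v : (Fin 3 → ℝ) → ℝ) (z : Fin 3 → ℝ) : Fin 6 → ℝ :=
  ![z 1, z 2, v z, vx v 1 z, vx v 2 z, vx v 3 z]

/-- The components of the prolonged vector field in the space of jets `(t, x, u, …, u_xxx)`. -/
noncomputable def vjetVel (τ ξ η v : (Fin 3 → ℝ) → ℝ) (z : Fin 3 → ℝ) : Fin 6 → ℝ :=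
  ![τ (lift v z), ξ (lift v z), η (lift v z), prol1 τ ξ η v z, prol2 τ ξ η v z, prol3 τ ξ η v z]

/-- The difference of the two sides of the equation `u_t = F u_xxxx + G`. -/
noncomputable def defect (F G : (Fin 6 → ℝ) → ℝ) (v : (Fin 3 → ℝ) → ℝ) (z : Fin 3 → ℝ) : ℝ :=
  vtx v 0 z - F (vjet v z) * vx v 4 z - G (vjet v z)

/-- The derivative of `defect` along the prolonged vector field. -/
noncomputable def defectVel (F G : (Fin 6 → ℝ) → ℝ) (τ ξ η v : (Fin 3 → ℝ) → ℝ)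
    (z : Fin 3 → ℝ) : ℝ :=
  prolT τ ξ η v z - ((∑ i, vjetVel τ ξ η v z i * pd i F (vjet v z)) * vx v 4 z
    + F (vjet v z) * prol4 τ ξ η v z) - ∑ i, vjetVel τ ξ η v z i * pd i G (vjet v z)

lemma base_vjet (v : (Fin 3 → ℝ) → ℝ) (z : Fin 3 → ℝ) : base (vjet v z) = lift v z := rfl

section Defect

variable {M : Set (Fin 3 → ℝ)} {Ω : Set (Fin 3 → ℝ)} {v τ ξ η : (Fin 3 → ℝ) → ℝ}
  {D : Set (Fin 6 → ℝ)} {F G : (Fin 6 → ℝ) → ℝ} {c : ℝ → Fin 3 → ℝ} {e : ℝ}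

namespace IsMovedBy

lemma continuousOn_vx (h : IsMovedBy M Ω τ ξ η v) {k : ℕ} (hk : k ≤ 6) :
    ContinuousOn (vx v k) Ω :=
  (contDiffOn_vx_of_le h.isOpen_dom h.smooth (m := 0) (by omega)).continuousOn

lemma continuousOn_vjet (h : IsMovedBy M Ω τ ξ η v) : ContinuousOn (vjet v) Ω := by
  rw [continuousOn_pi]
  intro i
  fin_cases i
  · exact (continuous_apply 1).continuousOn
  · exact (continuous_apply 2).continuousOn
  · exact h.continuousOn_vx (k := 0) (by omega)
  · exact h.continuousOn_vx (k := 1) (by omega)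
  · exact h.continuousOn_vx (k := 2) (by omega)
  · exact h.continuousOn_vx (k := 3) (by omega)

lemma continuousOn_lift (h : IsMovedBy M Ω τ ξ η v) : ContinuousOn (lift v) Ω := by
  rw [continuousOn_pi]
  intro i
  fin_cases i
  · exact (continuous_apply 1).continuousOn
  · exact (continuous_apply 2).continuousOn
  · exact h.continuousOn_vx (k := 0) (by omega)

/-- Along a curve with velocity `(1, τ, ξ)` the derivative of `v_{x^k}` is `∂_ε v_{x^k} + τ v_{tx^k}
+ ξ v_{x^{k+1}}`. The last two terms cancel the transport terms, leaving the prolonged vector field.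
-/
lemma hasDerivAt_vjet (h : IsMovedBy M Ω τ ξ η v) (hce : c e ∈ Ω)
    (hc : HasDerivAt c ![1, τ (lift v (c e)), ξ (lift v (c e))] e) :
    HasDerivAt (fun e => vjet v (c e)) (vjetVel τ ξ η v (c e)) e := by
  have hd : ∀ k ≤ 5, DifferentiableAt ℝ (vx v k) (c e) := fun k hk =>
    (hasPdOn_vx h.isOpen_dom h.smooth hk 0 _ hce).1
  have hx := hasDerivAt_pi.1 hc
  rw [hasDerivAt_pi]
  intro i
  fin_cases i
  · exact hx 1
  · exact hx 2
  · refine (hasDerivAt_comp_curve hc (hd 0 (by omega))).congr_deriv ?_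
    have := h.pde _ hce
    simp only [vtx, vx, vjetVel] at this ⊢
    rw [this]
    simp
    ring
  · refine (hasDerivAt_comp_curve hc (hd 1 (by omega))).congr_deriv ?_
    rw [h.pd_zero_vx_one hce]
    simp only [vtx, vx, vjetVel, prol1]
    simp
    ring
  · refine (hasDerivAt_comp_curve hc (hd 2 (by omega))).congr_deriv ?_
    rw [h.pd_zero_vx_two hce]
    simp only [vtx, vx, vjetVel, prol2]
    simp
    ring
  · refine (hasDerivAt_comp_curve hc (hd 3 (by omega))).congr_deriv ?_
    rw [h.pd_zero_vx_three hce]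
    simp only [vtx, vx, vjetVel, prol3]
    simp
    ring

/-- The same cancellation removes `v_{txxxx}`, `v_{xxxxx}`, `v_{tt}` and `v_{tx}` from the transport
terms of `v_xxxx` and `v_t`. The rest is the chain and product rule. -/
lemma hasDerivAt_defect (h : IsMovedBy M Ω τ ξ η v) (hce : c e ∈ Ω)
    (hc : HasDerivAt c ![1, τ (lift v (c e)), ξ (lift v (c e))] e)
    (hF : DifferentiableAt ℝ F (vjet v (c e))) (hG : DifferentiableAt ℝ G (vjet v (c e))) :
    HasDerivAt (fun e => defect F G v (c e)) (defectVel F G τ ξ η v (c e)) e := by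
  have hJ := h.hasDerivAt_vjet hce hc
  have h4 : HasDerivAt (fun e => vx v 4 (c e)) (prol4 τ ξ η v (c e)) e := by
    refine (hasDerivAt_comp_curve hc
      (hasPdOn_vx h.isOpen_dom h.smooth (by omega) 0 _ hce).1).congr_deriv ?_
    rw [h.pd_zero_vx_four hce]
    simp only [vtx, vx, prol4]
    ring
  have hT : HasDerivAt (fun e => vtx v 0 (c e)) (prolT τ ξ η v (c e)) e := by
    refine (hasDerivAt_comp_curve hc
      (hasPdOn_vtx h.isOpen_dom h.smooth (by omega) _ hce).1).congr_deriv ?_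
    rw [h.pd_zero_vtx_zero hce, (hasPdOn_vtx h.isOpen_dom h.smooth (by omega) _ hce).2]
    simp only [prolT]
    ring
  exact (hT.sub ((hasDerivAt_comp_pd (f := F) (c := fun e => vjet v (c e)) hF hJ).mul h4)).sub
    (hasDerivAt_comp_pd (f := G) (c := fun e => vjet v (c e)) hG hJ)

end IsMovedBy

/-- If `τ` depends on `t` only, all its derivatives in the other directions vanish. -/
lemma pd_eq_zero_of_base {τ₀ : ℝ → ℝ} (hM : IsOpen M) (hτ : ContDiffOn ℝ ∞ τ M)
    (h0 : ∀ p ∈ M, τ p = τ₀ (p 0)) {i : Fin 3} (hi : i ≠ 0) : Set.EqOn (pd i τ) (fun _ => 0) M := by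
  intro p hp
  have hd : DifferentiableAt ℝ τ p := (hτ.contDiffAt (hM.mem_nhds hp)).differentiableAt (by simp)
  have hline : HasDerivAt (fun s : ℝ => p + s • (Pi.single i 1 : Fin 3 → ℝ)) (Pi.single i 1) 0 := by
    simpa using ((hasDerivAt_id (0 : ℝ)).smul_const (Pi.single i 1 : Fin 3 → ℝ)).const_add p
  have h1 : HasDerivAt (fun s : ℝ => τ (p + s • (Pi.single i 1 : Fin 3 → ℝ))) (pd i τ p) 0 :=
    HasFDerivAt.comp_hasDerivAt (f := fun s : ℝ => p + s • (Pi.single i 1 : Fin 3 → ℝ)) 0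
      (by simpa using hd.hasFDerivAt) hline
  have h2 : (fun s : ℝ => τ (p + s • (Pi.single i 1 : Fin 3 → ℝ))) =ᶠ[𝓝 0] fun _ => τ₀ (p 0) := by
    have : ∀ᶠ s : ℝ in 𝓝 0, p + s • (Pi.single i 1 : Fin 3 → ℝ) ∈ M :=
      hline.continuousAt.eventually (by simpa using hM.mem_nhds hp)
    filter_upwards [this] with s hs
    rw [h0 _ hs]
    simp [hi.symm]
  exact h1.unique ((hasDerivAt_const (0 : ℝ) (τ₀ (p 0))).congr_of_eventuallyEq h2)

/-- No regularity of `τ₀` is assumed. Near `p 0` it coincides with `τ` on a line in the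
`t`-direction through `p`, which stays in the open set `M` for a short while. -/
lemma pd_zero_of_base {τ₀ : ℝ → ℝ} (hM : IsOpen M) (hτ : ContDiffOn ℝ ∞ τ M)
    (h0 : ∀ p ∈ M, τ p = τ₀ (p 0)) {p : Fin 3 → ℝ} (hp : p ∈ M) : pd 0 τ p = deriv τ₀ (p 0) := by
  have hd : DifferentiableAt ℝ τ p := (hτ.contDiffAt (hM.mem_nhds hp)).differentiableAt (by simp)
  have hline : HasDerivAt (fun s : ℝ => p + (s - p 0) • (Pi.single 0 1 : Fin 3 → ℝ))
      (Pi.single 0 1) (p 0) := by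
    simpa using (((hasDerivAt_id (p 0)).sub_const (p 0)).smul_const
      (Pi.single 0 1 : Fin 3 → ℝ)).const_add p
  have h1 : HasDerivAt (fun s : ℝ => τ (p + (s - p 0) • (Pi.single 0 1 : Fin 3 → ℝ)))
      (pd 0 τ p) (p 0) :=
    HasFDerivAt.comp_hasDerivAt (f := fun s : ℝ => p + (s - p 0) • (Pi.single 0 1 : Fin 3 → ℝ))
      (p 0) (by simpa using hd.hasFDerivAt) hline
  have h2 : τ₀ =ᶠ[𝓝 (p 0)] fun s : ℝ => τ (p + (s - p 0) • (Pi.single 0 1 : Fin 3 → ℝ)) := by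
    have : ∀ᶠ s : ℝ in 𝓝 (p 0), p + (s - p 0) • (Pi.single 0 1 : Fin 3 → ℝ) ∈ M :=
      hline.continuousAt.eventually (by simpa using hM.mem_nhds hp)
    filter_upwards [this] with s hs
    rw [h0 _ hs]
    simp
  exact ((h1.congr_of_eventuallyEq h2).deriv).symm

lemma pd_zero_fun (hM : IsOpen M) {f : (Fin 3 → ℝ) → ℝ} (hf : Set.EqOn f (fun _ => 0) M)
    (i : Fin 3) : Set.EqOn (pd i f) (fun _ => 0) M :=
  fun _ hp => ((HasPdOn.const (0 : ℝ)).pd_eq hM hf) hp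

/-- If `τ = τ₀(t)`, the derivative of the defect along the prolonged vector field is the combination
of the defect itself and the left-hand sides of the classifying equations. -/
lemma defectVel_eq {τ₀ : ℝ → ℝ} (hM : IsOpen M) (hτ : ContDiffOn ℝ ∞ τ M)
    (h0 : ∀ p ∈ M, τ p = τ₀ (p 0)) {z : Fin 3 → ℝ} (hz : lift v z ∈ M) :
    defectVel F G τ ξ η v z =
      (pd 2 η (lift v z) - deriv τ₀ (z 1) - vx v 1 z * pd 2 ξ (lift v z)) * defect F G v z
      + vx v 4 z *
        ((4 * pd 2 ξ (lift v z) * vx v 1 z + 4 * pd 1 ξ (lift v z) - deriv τ₀ (z 1))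
            * F (vjet v z)
          - τ₀ (z 1) * pd 0 F (vjet v z) - ξ (lift v z) * pd 1 F (vjet v z)
          - η (lift v z) * pd 2 F (vjet v z)
          + coeff1 ξ η (vjet v z) * pd 3 F (vjet v z) + coeff2 ξ η (vjet v z) * pd 4 F (vjet v z)
          + coeff3 ξ η (vjet v z) * pd 5 F (vjet v z))
      + (coeff4 ξ η (vjet v z) * F (vjet v z)
          + (pd 2 η (lift v z) - deriv τ₀ (z 1) - vx v 1 z * pd 2 ξ (lift v z)) * G (vjet v z)
          - τ₀ (z 1) * pd 0 G (vjet v z) - ξ (lift v z) * pd 1 G (vjet v z)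
          - η (lift v z) * pd 2 G (vjet v z)
          + coeff1 ξ η (vjet v z) * pd 3 G (vjet v z) + coeff2 ξ η (vjet v z) * pd 4 G (vjet v z)
          + coeff3 ξ η (vjet v z) * pd 5 G (vjet v z)
          - vx v 1 z * pd 0 ξ (lift v z) + pd 0 η (lift v z)) := by
  have Z1 := pd_eq_zero_of_base hM hτ h0 (i := 1) (by decide)
  have Z2 := pd_eq_zero_of_base hM hτ h0 (i := 2) (by decide)
  have Z := fun (i : Fin 3) {f} (hf : Set.EqOn f (fun _ => 0) M) => pd_zero_fun hM hf i
  have T0 : pd 0 τ (lift v z) = deriv τ₀ (z 1) := pd_zero_of_base hM hτ h0 hz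
  have T : τ (lift v z) = τ₀ (z 1) := h0 _ hz
  -- All total `x`-derivatives of `τ` vanish, which removes every mixed derivative `v_{tx^k}` with
  -- `k ≥ 1`.
  have t1 : ∀ a, total1 τ (lift v z) a = 0 := fun a => by simp [total1, Z1 hz, Z2 hz]
  have t2 : ∀ a b, total2 τ (lift v z) a b = 0 := fun a b => by
    simp [total2, Z 1 Z1 hz, Z 1 Z2 hz, Z 2 Z2 hz, Z2 hz]
  have t3 : ∀ a b c, total3 τ (lift v z) a b c = 0 := fun a b c => by
    simp [total3, Z 1 (Z 1 Z1) hz, Z 1 (Z 1 Z2) hz, Z 1 (Z 2 Z2) hz, Z 2 (Z 2 Z2) hz,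
      Z 1 Z2 hz, Z 2 Z2 hz, Z2 hz]
  have t4 : ∀ a b c d, total4 τ (lift v z) a b c d = 0 := fun a b c d => by
    simp [total4, Z 1 (Z 1 (Z 1 Z1)) hz, Z 1 (Z 1 (Z 1 Z2)) hz, Z 1 (Z 1 (Z 2 Z2)) hz,
      Z 1 (Z 2 (Z 2 Z2)) hz, Z 2 (Z 2 (Z 2 Z2)) hz, Z 1 (Z 1 Z2) hz, Z 1 (Z 2 Z2) hz,
      Z 2 (Z 2 Z2) hz, Z 1 Z2 hz, Z 2 Z2 hz, Z2 hz]
  -- The coefficients in the classifying equations are the negatives of the prolonged components.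
  have P1 : prol1 τ ξ η v z = -coeff1 ξ η (vjet v z) := by
    simp only [prol1, coeff1, t1, base_vjet]
    simp [vjet, total1]
    ring
  have P2 : prol2 τ ξ η v z = -coeff2 ξ η (vjet v z) := by
    simp only [prol2, coeff2, t1, t2, base_vjet]
    simp [vjet, total1, total2]
    ring
  have P3 : prol3 τ ξ η v z = -coeff3 ξ η (vjet v z) := by
    simp only [prol3, coeff3, t1, t2, t3, base_vjet]
    simp [vjet, total1, total2, total3]
    ring
  -- The part linear in `u_xxxx` is split off. Subtracting its factor from `λ` yields the factor `4
  -- u_x ξ_u + 4 ξ_x - τ'` of `F` in the first classifying equation.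
  have P4 : prol4 τ ξ η v z = -coeff4 ξ η (vjet v z)
      + (pd 2 η (lift v z) - 4 * pd 1 ξ (lift v z) - 5 * vx v 1 z * pd 2 ξ (lift v z))
        * vx v 4 z := by
    simp only [prol4, coeff4, t1, t2, t3, t4, base_vjet]
    simp [vjet, total1, total2, total3, total4]
    ring
  simp only [defectVel, defect, prolT, Fin.sum_univ_six, vjetVel, P1, P2, P3, P4, T, T0, Z2 hz]
  simp
  ring

end Defect

/-! ### Moving graphs by a local group -/

/-- The point `(ε, t, x)`. -/
def pt (ε : ℝ) (s : Fin 2 → ℝ) : Fin 3 → ℝ := ![ε, s 0, s 1]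

/-- The point `(t, x)` under `(ε, t, x)`. -/
def tl (z : Fin 3 → ℝ) : Fin 2 → ℝ := ![z 1, z 2]

lemma tl_pt (ε : ℝ) (s : Fin 2 → ℝ) : tl (pt ε s) = s := by
  ext i; fin_cases i <;> rfl

lemma pt_tl (z : Fin 3 → ℝ) : pt (z 0) (tl z) = z := by
  ext i; fin_cases i <;> rfl

lemma contDiff_tl : ContDiff ℝ ∞ tl := by
  rw [contDiff_pi]
  intro i
  fin_cases i
  · exact contDiff_apply ℝ ℝ (1 : Fin 3)
  · exact contDiff_apply ℝ ℝ (2 : Fin 3)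

lemma contDiff_pt (ε : ℝ) : ContDiff ℝ ∞ (pt ε) := by
  rw [contDiff_pi]
  intro i
  fin_cases i
  · exact contDiff_const
  · exact contDiff_apply ℝ ℝ (0 : Fin 2)
  · exact contDiff_apply ℝ ℝ (1 : Fin 2)

lemma continuous_pt_left (s : Fin 2 → ℝ) : Continuous fun ε => pt ε s := by
  rw [continuous_pi_iff]
  intro i
  fin_cases i
  · exact continuous_id
  · exact continuous_const
  · exact continuous_const

lemma contDiffOn_graphPt {n : WithTop ℕ∞} {f : (Fin 2 → ℝ) → ℝ} {U : Set (Fin 2 → ℝ)}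
    (hf : ContDiffOn ℝ n f U) : ContDiffOn ℝ n (graphPt f) U := by
  rw [contDiffOn_pi]
  intro i
  fin_cases i
  · exact (contDiff_apply ℝ ℝ (0 : Fin 2)).contDiffOn
  · exact (contDiff_apply ℝ ℝ (1 : Fin 2)).contDiffOn
  · exact hf

section Flow

variable {M : Set (Fin 3 → ℝ)} {Φ : LocalGroup M} {τ ξ η : (Fin 3 → ℝ) → ℝ}

/-- Orbits of a local group are integral curves of its generator. -/
lemma IsGenerator.hasDerivAt (hΦ : IsGenerator Φ τ ξ η) {ε : ℝ} {p : Fin 3 → ℝ}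
    (hp : (ε, p) ∈ Φ.dom) :
    HasDerivAt (fun e => Φ.act e p) ![τ (Φ.act ε p), ξ (Φ.act ε p), η (Φ.act ε p)] ε := by
  have hq := Φ.act_mem ε p hp
  -- By the group law the orbit near `ε` is the orbit of `Φ.act ε p` near parameter 0, where the
  -- generator gives the velocity.
  have h1 : HasDerivAt (fun e => Φ.act (e - ε) (Φ.act ε p))
      ![τ (Φ.act ε p), ξ (Φ.act ε p), η (Φ.act ε p)] ε := by
    have := hΦ _ hq
    rw [← sub_self ε] at this
    exact HasDerivAt.comp_sub_const ε ε this
  refine h1.congr_of_eventuallyEq ?_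
  have e1 : ∀ᶠ e in 𝓝 ε, (e, p) ∈ Φ.dom :=
    (Continuous.prodMk_left p).continuousAt.eventually (Φ.isOpen_dom.mem_nhds hp)
  have e2 : ∀ᶠ e in 𝓝 ε, (e - ε, Φ.act ε p) ∈ Φ.dom := by
    have hc : ContinuousAt (fun e : ℝ => (e - ε, Φ.act ε p)) ε := by fun_prop
    exact hc.eventually (Φ.isOpen_dom.mem_nhds (by simpa using Φ.zero_mem _ hq))
  filter_upwards [e1, e2] with e he1 he2
  rw [Φ.act_act _ _ _ hp he2 (by simpa using he1)]
  simp

variable {f : (Fin 2 → ℝ) → ℝ} {s : Fin 2 → ℝ}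

/-- The map `(ε, t, x) ↦ (ε, t', x')`, where `(t', x')` is the image of `(t, x)` when the graph of
`f` is moved by the transformation with parameter `ε`. -/
def movedMap (Φ : LocalGroup M) (f : (Fin 2 → ℝ) → ℝ) (z : Fin 3 → ℝ) : Fin 3 → ℝ :=
  pt (z 0) (movedPt Φ (z 0) f (tl z))

lemma movedPt_zero (h : graphPt f s ∈ M) : movedPt Φ 0 f s = s := by
  ext i
  unfold movedPt
  rw [Φ.act_zero _ h]
  fin_cases i <;> rfl

lemma continuousAt_graphPt (hf : ContinuousAt f s) : ContinuousAt (graphPt f) s := by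
  rw [continuousAt_pi]
  intro i
  fin_cases i
  · exact continuousAt_apply 0 s
  · exact continuousAt_apply 1 s
  · exact hf

lemma movedMap_pt (Φ : LocalGroup M) (f : (Fin 2 → ℝ) → ℝ) (ε : ℝ) (s : Fin 2 → ℝ) :
    movedMap Φ f (pt ε s) = pt ε (movedPt Φ ε f s) := by
  simp [movedMap, tl_pt]; rfl

/-- A chart that straightens the moved graphs of `f` near `s`. -/
structure FlowChart (Φ : LocalGroup M) (f : (Fin 2 → ℝ) → ℝ) (s : Fin 2 → ℝ)
    (n : WithTop ℕ∞) where
  /-- the chart `(ε, t, x) ↦ (ε, t', x')` -/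
  chart : OpenPartialHomeomorph (Fin 3 → ℝ) (Fin 3 → ℝ)
  mem_source : pt 0 s ∈ chart.source
  chart_eq : ∀ z ∈ chart.source, chart z = movedMap Φ f z
  mem_dom : ∀ z ∈ chart.source, (z 0, graphPt f (tl z)) ∈ Φ.dom
  smooth_symm : ContDiffOn ℝ n chart.symm chart.target
  smooth_act : ContDiffOn ℝ n (fun z => Φ.act (z 0) (graphPt f (tl z))) chart.source

/-- The map preserves `ε`, so a kernel vector has no `ε`-component. On the slice `ε = 0` the map is
the identity, so its derivative fixes such a vector, which is therefore 0. -/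
lemma fderiv_movedMap_injective (hM : IsOpen M) (hf : ContinuousAt f s) (hs : graphPt f s ∈ M)
    {L : (Fin 3 → ℝ) →L[ℝ] (Fin 3 → ℝ)} (hL : HasFDerivAt (movedMap Φ f) L (pt 0 s)) :
    Function.Injective L := by
  have h0 : ∀ w, L w 0 = w 0 := by
    have := ((hasFDerivAt_pi'.1 hL) 0).unique (hasFDerivAt_apply (0 : Fin 3) (pt 0 s))
    intro w
    exact congrArg (fun A => A w) this
  rw [injective_iff_map_eq_zero]
  intro w hw
  have hw0 : w 0 = 0 := by rw [← h0 w, hw]; rfl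
  have hline : HasDerivAt (fun r : ℝ => pt 0 s + r • w) w 0 := by
    simpa using ((hasDerivAt_id (0 : ℝ)).smul_const w).const_add (pt 0 s)
  have h1 : HasDerivAt (fun r : ℝ => movedMap Φ f (pt 0 s + r • w)) (L w) 0 :=
    by
    have hL' : HasFDerivAt (movedMap Φ f) L (pt 0 s + (0 : ℝ) • w) := by rwa [zero_smul, add_zero]
    exact HasFDerivAt.comp_hasDerivAt (f := fun r : ℝ => pt 0 s + r • w) 0 hL' hline
  have h2 : (fun r : ℝ => movedMap Φ f (pt 0 s + r • w)) =ᶠ[𝓝 0] fun r => pt 0 s + r • w := by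
    have hc : ContinuousAt (fun r : ℝ => tl (pt 0 s + r • w)) 0 :=
      contDiff_tl.continuous.continuousAt.comp hline.continuousAt
    have h3 : ∀ᶠ r : ℝ in 𝓝 0, graphPt f (tl (pt 0 s + r • w)) ∈ M := by
      refine hc.eventually (p := fun q => graphPt f q ∈ M) ?_
      simp only [zero_smul, add_zero, tl_pt]
      exact (continuousAt_graphPt hf).eventually (hM.mem_nhds hs)
    filter_upwards [h3] with r hr
    have hz : (pt 0 s + r • w) 0 = 0 := by simp [hw0, pt]
    have h4 := pt_tl (pt 0 s + r • w)
    rw [hz] at h4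
    unfold movedMap
    rw [hz, movedPt_zero hr, h4]
  rw [← (h1.congr_of_eventuallyEq h2.symm).unique hline, hw]

/-- Flow charts exist. -/
lemma exists_flowChart (hM : IsOpen M) {n : WithTop ℕ∞} (hn : 1 ≤ n) (hn' : n ≤ ∞)
    {U : Set (Fin 2 → ℝ)} (hU : IsOpen U) (hsU : s ∈ U) (hf : ContDiffOn ℝ n f U)
    (hs : graphPt f s ∈ M) : Nonempty (FlowChart Φ f s n) := by
  have hn0 : n ≠ 0 := (zero_lt_one.trans_le hn).ne'
  have hgr : ContDiffOn ℝ n (fun z : Fin 3 → ℝ => (z 0, graphPt f (tl z))) (tl ⁻¹' U) :=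
    ((contDiff_apply ℝ ℝ (0 : Fin 3)).contDiffOn).prodMk
      ((contDiffOn_graphPt hf).comp (contDiff_tl.of_le hn').contDiffOn fun _ h => h)
  set W : Set (Fin 3 → ℝ) := tl ⁻¹' U ∩ (fun z => (z 0, graphPt f (tl z))) ⁻¹' Φ.dom with hW
  have hWo : IsOpen W := hgr.continuousOn.isOpen_inter_preimage
    (hU.preimage contDiff_tl.continuous) Φ.isOpen_dom
  have hact : ContDiffOn ℝ n (fun z => Φ.act (z 0) (graphPt f (tl z))) W :=
    (Φ.smooth.of_le hn').comp (hgr.mono Set.inter_subset_left) fun z hz => hz.2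
  have hmap : ContDiffOn ℝ n (movedMap Φ f) W := by
    rw [contDiffOn_pi] at hact ⊢
    intro i
    fin_cases i
    · exact (contDiff_apply ℝ ℝ (0 : Fin 3)).contDiffOn
    · exact hact 0
    · exact hact 1
  have hz0 : pt 0 s ∈ W := by
    refine ⟨by simpa [tl_pt] using hsU, ?_⟩
    rw [Set.mem_preimage, tl_pt]
    exact Φ.zero_mem _ hs
  -- The chart from the inverse function theorem is restricted to the open set where the derivative
  -- is invertible, so that its inverse is smooth on the whole target and not only at one point.
  set S : Set (Fin 3 → ℝ) := W ∩ fderiv ℝ (movedMap Φ f) ⁻¹'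
    Set.range ((↑) : ((Fin 3 → ℝ) ≃L[ℝ] (Fin 3 → ℝ)) → (Fin 3 → ℝ) →L[ℝ] (Fin 3 → ℝ)) with hS
  have hSo : IsOpen S :=
    (hmap.continuousOn_fderiv_of_isOpen hWo hn).isOpen_inter_preimage hWo
      ContinuousLinearEquiv.isOpen
  have hd : ∀ z ∈ W, HasFDerivAt (movedMap Φ f) (fderiv ℝ (movedMap Φ f) z) z := fun z hz =>
    ((hmap.contDiffAt (hWo.mem_nhds hz)).differentiableAt hn0).hasFDerivAt
  have hinj := fderiv_movedMap_injective hM ((hf.contDiffAt (hU.mem_nhds hsU)).continuousAt) hs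
    (hd _ hz0)
  obtain ⟨A, hA⟩ : fderiv ℝ (movedMap Φ f) (pt 0 s) ∈ Set.range
      ((↑) : ((Fin 3 → ℝ) ≃L[ℝ] (Fin 3 → ℝ)) → (Fin 3 → ℝ) →L[ℝ] (Fin 3 → ℝ)) :=
    ⟨(LinearEquiv.ofInjectiveEndo _ hinj).toContinuousLinearEquiv, by ext; rfl⟩
  have hA' : HasFDerivAt (movedMap Φ f) (A : (Fin 3 → ℝ) →L[ℝ] (Fin 3 → ℝ)) (pt 0 s) := by
    rw [hA]
    exact hd _ hz0
  have hat := hmap.contDiffAt (hWo.mem_nhds hz0)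
  let e := (hat.toOpenPartialHomeomorph _ hA' hn0).restrOpen S hSo
  have hcoe : ∀ z, e z = movedMap Φ f z := fun z => rfl
  have hsrc : ∀ z ∈ e.source, z ∈ S := fun z hz => hz.2
  refine ⟨⟨e, ⟨hat.mem_toOpenPartialHomeomorph_source hA' hn0, hz0, ⟨A, hA⟩⟩, fun z _ => hcoe z,
    fun z hz => (hsrc z hz).1.2, ?_, hact.mono fun z hz => (hsrc z hz).1⟩⟩
  intro y hy
  have hx := hsrc _ (e.map_target hy)
  obtain ⟨B, hB⟩ := hx.2
  refine (e.contDiffAt_symm hy (f₀' := B) ?_ ?_).contDiffWithinAt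
  · rw [hB]
    exact hd _ hx.1
  · exact hmap.contDiffAt (hWo.mem_nhds hx.1)

namespace FlowChart

variable {n : WithTop ℕ∞} (C : FlowChart Φ f s n)

/-- The moved graphs, as a function of `(ε, t, x)`. -/
def moved (y : Fin 3 → ℝ) : ℝ :=
  Φ.act (C.chart.symm y 0) (graphPt f (tl (C.chart.symm y))) 2

lemma moved_movedMap {z : Fin 3 → ℝ} (hz : z ∈ C.chart.source) :
    C.moved (movedMap Φ f z) = Φ.act (z 0) (graphPt f (tl z)) 2 := by
  rw [← C.chart_eq z hz, moved, C.chart.left_inv hz]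

lemma movedMap_mem {z : Fin 3 → ℝ} (hz : z ∈ C.chart.source) :
    movedMap Φ f z ∈ C.chart.target := by
  rw [← C.chart_eq z hz]
  exact C.chart.map_source hz

lemma movedMap_symm {y : Fin 3 → ℝ} (hy : y ∈ C.chart.target) :
    movedMap Φ f (C.chart.symm y) = y := by
  rw [← C.chart_eq _ (C.chart.map_target hy), C.chart.right_inv hy]

lemma lift_moved {y : Fin 3 → ℝ} (hy : y ∈ C.chart.target) :
    lift C.moved y = Φ.act (C.chart.symm y 0) (graphPt f (tl (C.chart.symm y))) := by
  have h := C.movedMap_symm hy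
  ext i
  fin_cases i
  · exact (congrFun h 1).symm
  · exact (congrFun h 2).symm
  · rfl

lemma lift_moved_movedMap {z : Fin 3 → ℝ} (hz : z ∈ C.chart.source) :
    lift C.moved (movedMap Φ f z) = Φ.act (z 0) (graphPt f (tl z)) := by
  rw [C.lift_moved (C.movedMap_mem hz), ← C.chart_eq z hz, C.chart.left_inv hz]

lemma contDiffOn_moved : ContDiffOn ℝ n C.moved C.chart.target :=
  (contDiffOn_pi.1 C.smooth_act 2).comp C.smooth_symm fun _ hy => C.chart.map_target hy

/-- The `t`- and `x`-components follow an orbit of the group, and the point of the moved graph above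
them is the orbit itself. This supplies the curve of velocity `(1, τ, ξ)` used for the defect. -/
lemma hasDerivAt_movedMap (hΦ : IsGenerator Φ τ ξ η) {ε : ℝ} {s' : Fin 2 → ℝ}
    (hz : pt ε s' ∈ C.chart.source) :
    HasDerivAt (fun e => movedMap Φ f (pt e s'))
      ![1, τ (lift C.moved (movedMap Φ f (pt ε s'))), ξ (lift C.moved (movedMap Φ f (pt ε s')))]
      ε := by
  have h := hΦ.hasDerivAt (C.mem_dom _ hz)
  rw [C.lift_moved_movedMap hz]
  rw [tl_pt] at h ⊢
  rw [hasDerivAt_pi] at h ⊢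
  intro i
  fin_cases i
  · exact hasDerivAt_id ε
  · have := h 0
    simp only [movedMap, movedPt, tl_pt]
    exact this
  · have := h 1
    simp only [movedMap, movedPt, tl_pt]
    exact this

/-- Follow one point of the original graph. The value of `moved` along its path is the `u`-component
of the orbit, with derivative `η`; by the chain rule the same derivative is `v_ε + τ v_t + ξ v_x`.
-/
lemma isMovedBy (hM : IsOpen M) (hτ : ContDiffOn ℝ ∞ τ M) (hξ : ContDiffOn ℝ ∞ ξ M)
    (hη : ContDiffOn ℝ ∞ η M) (hΦ : IsGenerator Φ τ ξ η) (hn : 6 ≤ n) :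
    IsMovedBy M C.chart.target τ ξ η C.moved where
  isOpen_base := hM
  isOpen_dom := C.chart.open_target
  smooth_tau := hτ
  smooth_xi := hξ
  smooth_eta := hη
  smooth := C.contDiffOn_moved.of_le hn
  lift_mem y hy := by
    rw [C.lift_moved hy]
    exact Φ.act_mem _ _ (C.mem_dom _ (C.chart.map_target hy))
  pde y hy := by
    set z := C.chart.symm y with hzdef
    have hz : z ∈ C.chart.source := C.chart.map_target hy
    have hyz : movedMap Φ f (pt (z 0) (tl z)) = y := by rw [pt_tl]; exact C.movedMap_symm hy
    have hz' : pt (z 0) (tl z) ∈ C.chart.source := by rwa [pt_tl]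
    have hc := C.hasDerivAt_movedMap hΦ hz'
    have hdiff : DifferentiableAt ℝ C.moved (movedMap Φ f (pt (z 0) (tl z))) := by
      rw [hyz]
      exact (C.contDiffOn_moved.contDiffAt (C.chart.open_target.mem_nhds hy)).differentiableAt
        ((by norm_num : (0 : WithTop ℕ∞) < 6).trans_le hn).ne'
    have h1 := hasDerivAt_comp_curve hc hdiff
    have h2 : HasDerivAt (fun e => C.moved (movedMap Φ f (pt e (tl z))))
        (η (lift C.moved y)) (z 0) := by
      have h3 := (hasDerivAt_pi.1 (hΦ.hasDerivAt (C.mem_dom _ hz))) 2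
      rw [← C.lift_moved hy] at h3
      refine h3.congr_of_eventuallyEq ?_
      have : ∀ᶠ e in 𝓝 (z 0), pt e (tl z) ∈ C.chart.source :=
        (continuous_pt_left (tl z)).continuousAt.eventually (C.chart.open_source.mem_nhds hz')
      filter_upwards [this] with e he
      rw [C.moved_movedMap he, tl_pt]
      rfl
    have h3 := h1.unique h2
    rw [hyz] at h3
    simp only [vtx, vx]
    linarith

lemma eventually_mem_source : ∀ᶠ ε in 𝓝 (0 : ℝ), pt ε s ∈ C.chart.source :=
  (continuous_pt_left s).continuousAt.eventually (C.chart.open_source.mem_nhds C.mem_source)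

/-- Any transform of `f` is a time slice of the moved graphs. -/
lemma eventuallyEq_of_transform {ε : ℝ} (hε : pt ε s ∈ C.chart.source) {g : (Fin 2 → ℝ) → ℝ}
    (hg : ∀ᶠ s' in 𝓝 s, g (movedPt Φ ε f s') = Φ.act ε (graphPt f s') 2) :
    g =ᶠ[𝓝 (movedPt Φ ε f s)] fun y => C.moved (pt ε y) := by
  have hy0 : pt ε (movedPt Φ ε f s) = movedMap Φ f (pt ε s) :=
    (movedMap_pt Φ f ε s).symm
  have hy : pt ε (movedPt Φ ε f s) ∈ C.chart.target := by
    rw [hy0]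
    exact C.movedMap_mem hε
  have hcont : ContinuousAt (pt ε) (movedPt Φ ε f s) := (contDiff_pt ε).continuous.continuousAt
  have h1 : ∀ᶠ y in 𝓝 (movedPt Φ ε f s), pt ε y ∈ C.chart.target :=
    hcont.eventually (C.chart.open_target.mem_nhds hy)
  -- Points near the moved point pull back to points near `s`, where `g` is prescribed by the moved
  -- graph.
  have hc : ContinuousAt (fun y => tl (C.chart.symm (pt ε y))) (movedPt Φ ε f s) :=
    contDiff_tl.continuous.continuousAt.comp
      (ContinuousAt.comp (C.chart.continuousAt_symm hy) hcont)
  have hval : tl (C.chart.symm (pt ε (movedPt Φ ε f s))) = s := by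
    rw [hy0, ← C.chart_eq _ hε, C.chart.left_inv hε, tl_pt]
  have h2 : ∀ᶠ y in 𝓝 (movedPt Φ ε f s),
      g (movedPt Φ ε f (tl (C.chart.symm (pt ε y))))
        = Φ.act ε (graphPt f (tl (C.chart.symm (pt ε y)))) 2 :=
    hc.eventually (p := fun s' => g (movedPt Φ ε f s') = Φ.act ε (graphPt f s') 2)
      (by simpa only [hval] using hg)
  filter_upwards [h1, h2] with y hy1 hy2
  have h := C.movedMap_symm hy1
  have h0 : C.chart.symm (pt ε y) 0 = ε := congrFun h 0
  have h3 : movedPt Φ ε f (tl (C.chart.symm (pt ε y))) = y := by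
    have := congrArg tl h
    rwa [movedMap, tl_pt, tl_pt, h0] at this
  rw [h3] at hy2
  rw [hy2, moved, h0]

end FlowChart

/-- The time slices of the moved graphs are transforms of `f`. -/
lemma FlowChart.isTransform (C : FlowChart Φ f s ∞) {ε : ℝ} (hε : pt ε s ∈ C.chart.source) :
    IsTransform Φ ε f s fun y => C.moved (pt ε y) := by
  have hmv : ∀ s', pt ε (movedPt Φ ε f s') = movedMap Φ f (pt ε s') := fun s' =>
    (movedMap_pt Φ f ε s').symm
  refine ⟨?_, ?_⟩
  · refine ContDiffAt.comp (g := C.moved) _ ?_ (contDiff_pt ε).contDiffAt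
    rw [hmv]
    exact C.contDiffOn_moved.contDiffAt (C.chart.open_target.mem_nhds (C.movedMap_mem hε))
  · have : ∀ᶠ s' in 𝓝 s, pt ε s' ∈ C.chart.source :=
      (contDiff_pt ε).continuous.continuousAt.eventually (C.chart.open_source.mem_nhds hε)
    filter_upwards [this] with s' hs'
    rw [hmv, C.moved_movedMap hs', tl_pt]
    rfl

end Flow

/-! ### Jets of time slices -/

lemma six_le_infty : (6 : WithTop ℕ∞) ≤ ∞ :=
  WithTop.coe_le_coe.2 (le_top : (6 : ℕ∞) ≤ ⊤)

lemma pd_comp_pt (k : Fin 2) {w : (Fin 3 → ℝ) → ℝ} {ε : ℝ} {y : Fin 2 → ℝ}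
    (hw : DifferentiableAt ℝ w (pt ε y)) :
    pd k (fun y => w (pt ε y)) y = pd k.succ w (pt ε y) := by
  rw [pd_comp hw ((contDiff_pt ε).differentiable (by simp) y), Fin.sum_univ_three]
  have h0 : pd k (fun z => pt ε z 0) y = 0 :=
    ((HasPdOn.const (i := k) (Ω := Set.univ) ε) y trivial).2
  have h1 : pd k (fun z => pt ε z 1) y = (Pi.single k 1 : Fin 2 → ℝ) 0 :=
    ((HasPdOn.coord (i := k) (Ω := Set.univ) (0 : Fin 2)) y trivial).2
  have h2 : pd k (fun z => pt ε z 2) y = (Pi.single k 1 : Fin 2 → ℝ) 1 :=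
    ((HasPdOn.coord (i := k) (Ω := Set.univ) (1 : Fin 2)) y trivial).2
  rw [h0, h1, h2]
  fin_cases k <;> simp

section Slices

variable {M : Set (Fin 3 → ℝ)} {Ω : Set (Fin 3 → ℝ)} {v τ ξ η : (Fin 3 → ℝ) → ℝ}
  {D : Set (Fin 6 → ℝ)} {F G : (Fin 6 → ℝ) → ℝ} {g : (Fin 2 → ℝ) → ℝ} {ε : ℝ} {y : Fin 2 → ℝ}

namespace IsMovedBy

/-- Equality is carried on a neighbourhood, not just at `y`, so that it can be differentiated again.
-/
lemma iterate_pd_slice (h : IsMovedBy M Ω τ ξ η v) (hy : pt ε y ∈ Ω)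
    (hg : g =ᶠ[𝓝 y] fun y => v (pt ε y)) {k : ℕ} (hk : k ≤ 6) :
    (pd 1)^[k] g =ᶠ[𝓝 y] fun y => vx v k (pt ε y) := by
  induction k with
  | zero => exact hg
  | succ k ih =>
    rw [Function.iterate_succ_apply']
    refine (pd_eventuallyEq (ih (by omega))).trans ?_
    have : ∀ᶠ y' in 𝓝 y, pt ε y' ∈ Ω :=
      (contDiff_pt ε).continuous.continuousAt.eventually (h.isOpen_dom.mem_nhds hy)
    filter_upwards [this] with y' hy'
    exact pd_comp_pt 1 (hasPdOn_vx h.isOpen_dom h.smooth (by omega) 0 _ hy').1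

lemma iterate_pd_slice_eq (h : IsMovedBy M Ω τ ξ η v) (hy : pt ε y ∈ Ω)
    (hg : g =ᶠ[𝓝 y] fun y => v (pt ε y)) {k : ℕ} (hk : k ≤ 6) :
    (pd 1)^[k] g y = vx v k (pt ε y) :=
  (h.iterate_pd_slice hy hg hk).eq_of_nhds

lemma pd_zero_iterate_pd_slice (h : IsMovedBy M Ω τ ξ η v) (hy : pt ε y ∈ Ω)
    (hg : g =ᶠ[𝓝 y] fun y => v (pt ε y)) {k : ℕ} (hk : k ≤ 5) :
    pd 0 ((pd 1)^[k] g) y = vtx v k (pt ε y) :=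
  (pd_congr_of_eventuallyEq (h.iterate_pd_slice hy hg (by omega))).trans
    (pd_comp_pt 0 (hasPdOn_vx h.isOpen_dom h.smooth (by omega) 0 _ hy).1)

lemma jet_slice (h : IsMovedBy M Ω τ ξ η v) (hy : pt ε y ∈ Ω)
    (hg : g =ᶠ[𝓝 y] fun y => v (pt ε y)) : jet g y = vjet v (pt ε y) := by
  have h0 := h.iterate_pd_slice_eq hy hg (k := 0) (by omega)
  have h1 := h.iterate_pd_slice_eq hy hg (k := 1) (by omega)
  have h2 := h.iterate_pd_slice_eq hy hg (k := 2) (by omega)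
  have h3 := h.iterate_pd_slice_eq hy hg (k := 3) (by omega)
  ext i
  fin_cases i
  · rfl
  · rfl
  · exact h0
  · exact h1
  · exact h2
  · exact h3

lemma onEquation_iff (h : IsMovedBy M Ω τ ξ η v) (hy : pt ε y ∈ Ω)
    (hg : g =ᶠ[𝓝 y] fun y => v (pt ε y)) :
    OnEquation D F G g y ↔ vjet v (pt ε y) ∈ D ∧ defect F G v (pt ε y) = 0 := by
  have h4 : pd 1 (pd 1 (pd 1 (pd 1 g))) y = vx v 4 (pt ε y) :=
    h.iterate_pd_slice_eq hy hg (k := 4) (by omega)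
  have ht : pd 0 g y = vtx v 0 (pt ε y) := h.pd_zero_iterate_pd_slice hy hg (k := 0) (by omega)
  unfold OnEquation defect
  rw [h.jet_slice hy hg, h4, ht, sub_sub, sub_eq_zero]

end IsMovedBy

end Slices

/-! ### Sufficiency of the classifying equations, and the infinitesimal criterion -/

section Flow

variable {M : Set (Fin 3 → ℝ)} {Φ : LocalGroup M} {τ ξ η : (Fin 3 → ℝ) → ℝ}
  {f : (Fin 2 → ℝ) → ℝ} {s : Fin 2 → ℝ} {n : WithTop ℕ∞}
  {D : Set (Fin 6 → ℝ)} {F G : (Fin 6 → ℝ) → ℝ}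

/-- The transformation with parameter 0 is the identity, so `f` is its own transform. -/
lemma FlowChart.eventuallyEq_zero (C : FlowChart Φ f s n) (hM : IsOpen M) (hf : ContinuousAt f s)
    (hs : graphPt f s ∈ M) : f =ᶠ[𝓝 s] fun y => C.moved (pt 0 y) := by
  have h := C.eventuallyEq_of_transform C.mem_source (g := f) (by
    filter_upwards [(continuousAt_graphPt hf).eventually (hM.mem_nhds hs)] with s' hs'
    rw [movedPt_zero hs', Φ.act_zero _ hs']
    rfl)
  rwa [movedPt_zero hs] at h

/-- The classifying equations are sufficient. -/
lemma isSymmetryGroup_of_class (hD : IsOpen D) (hF : ContDiffOn ℝ ∞ F D) (hG : ContDiffOn ℝ ∞ G D)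
    (hM : IsOpen M) (hDM : ∀ q ∈ D, base q ∈ M)
    (hτ : ContDiffOn ℝ ∞ τ M) (hξ : ContDiffOn ℝ ∞ ξ M) (hη : ContDiffOn ℝ ∞ η M)
    (hΦ : IsGenerator Φ τ ξ η) {τ₀ : ℝ → ℝ} (h0 : ∀ p ∈ M, τ p = τ₀ (p 0))
    (hcl : ∀ q ∈ D, Class1 F τ₀ ξ η q ∧ Class2 F G τ₀ ξ η q) : IsSymmetryGroup D F G Φ := by
  intro f s hf hon
  have hs : graphPt f s ∈ M := hDM _ hon.1
  -- `ContDiffAt ℝ ∞` at one point gives, for each finite order, a neighbourhood that may shrink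
  -- with the order. Order 6 covers all derivatives used.
  obtain ⟨U, hU, hfU⟩ := hf.contDiffOn (m := 6) six_le_infty (by simp)
  obtain ⟨U', hU'U, hU'o, hsU'⟩ := mem_nhds_iff.1 hU
  obtain ⟨C⟩ := exists_flowChart (Φ := Φ) hM (n := 6) (by norm_num) six_le_infty
    hU'o hsU' (hfU.mono hU'U) hs
  have h := C.isMovedBy hM hτ hξ hη hΦ le_rfl
  set v := C.moved with hv
  set c : ℝ → Fin 3 → ℝ := fun ε => movedMap Φ f (pt ε s) with hc
  have hc0 : c 0 = pt 0 s := by rw [hc]; simp only [movedMap_pt, movedPt_zero hs]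
  have hsrc := C.eventually_mem_source
  have hcm : ∀ {ε}, pt ε s ∈ C.chart.source → c ε ∈ C.chart.target := fun hε => C.movedMap_mem hε
  have hc0m : c 0 ∈ C.chart.target := hcm C.mem_source
  have hzero : OnEquation D F G f s ↔ vjet v (pt 0 s) ∈ D ∧ defect F G v (pt 0 s) = 0 :=
    h.onEquation_iff (hc0 ▸ hc0m) (C.eventuallyEq_zero hM hf.continuousAt hs)
  have hcd : ∀ {ε}, pt ε s ∈ C.chart.source →
      HasDerivAt c ![1, τ (lift v (c ε)), ξ (lift v (c ε))] ε := fun hε =>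
    C.hasDerivAt_movedMap hΦ hε
  have hcc : ContinuousAt c 0 := (hcd C.mem_source).continuousAt
  have hΩ : C.chart.target ∈ 𝓝 (c 0) := C.chart.open_target.mem_nhds hc0m
  have hjD : ∀ᶠ ε in 𝓝 (0 : ℝ), vjet v (c ε) ∈ D := by
    have h1 : ContinuousAt (fun ε => vjet v (c ε)) 0 :=
      ContinuousAt.comp (f := c) (h.continuousOn_vjet.continuousAt hΩ) hcc
    refine h1.eventually (hD.mem_nhds ?_)
    simp only [hc0]
    exact (hzero.1 hon).1
  -- The factor `λ` along the orbit, written with `pd 0 τ` instead of `deriv τ₀` because its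
  -- continuity is then immediate.
  set lam : ℝ → ℝ := fun ε => pd 2 η (lift v (c ε)) - pd 0 τ (lift v (c ε))
    - vx v 1 (c ε) * pd 2 ξ (lift v (c ε)) with hlam
  have hlamc : ContinuousAt lam 0 := by
    have hl : ContinuousAt (fun ε => lift v (c ε)) 0 :=
      ContinuousAt.comp (f := c) (h.continuousOn_lift.continuousAt hΩ) hcc
    have hp : ∀ {ψ} (i : Fin 3), ContDiffOn ℝ ∞ ψ M →
        ContinuousAt (fun ε => pd i ψ (lift v (c ε))) 0 := fun i hψ =>
      ContinuousAt.comp (f := fun ε => lift v (c ε))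
        ((contDiffOn_pd_infty hM hψ).continuousOn.continuousAt (hM.mem_nhds (h.lift_mem _ hc0m))) hl
    exact ((hp 2 hη).sub (hp 0 hτ)).sub ((ContinuousAt.comp (f := c)
      ((h.continuousOn_vx (by omega)).continuousAt hΩ) hcc).mul (hp 2 hξ))
  have hode : ∀ᶠ ε in 𝓝 (0 : ℝ),
      HasDerivAt (fun ε => defect F G v (c ε)) (lam ε * defect F G v (c ε)) ε ∧
        defect F G v (c ε) ∈ (Set.univ : Set ℝ) := by
    filter_upwards [hsrc, hjD] with ε hε hεD
    refine ⟨?_, trivial⟩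
    have hz := h.lift_mem _ (hcm hε)
    refine (h.hasDerivAt_defect (hcm hε) (hcd hε)
      ((hF.contDiffAt (hD.mem_nhds hεD)).differentiableAt (by simp))
      ((hG.contDiffAt (hD.mem_nhds hεD)).differentiableAt (by simp))).congr_deriv ?_
    obtain ⟨c1, c2⟩ := hcl _ hεD
    rw [defectVel_eq hM hτ h0 hz, hlam]
    simp only [Class1, Class2, base_vjet] at c1 c2
    have e0 : vjet v (c ε) 0 = c ε 1 := rfl
    have e3 : vjet v (c ε) 3 = vx v 1 (c ε) := rfl
    have et : pd 0 τ (lift v (c ε)) = deriv τ₀ (c ε 1) := pd_zero_of_base hM hτ h0 hz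
    rw [e0, e3] at c1 c2
    simp only [c1, c2, et]
    ring
  -- Continuity bounds `|λ|` by `|λ(0)| + 1` near 0. This is the Lipschitz constant for comparing
  -- the defect with the zero solution.
  have hbd : ∀ᶠ ε in 𝓝 (0 : ℝ),
      LipschitzOnWith (Real.toNNReal (|lam 0| + 1)) (fun x => lam ε * x) Set.univ := by
    have := hlamc.abs.eventually (gt_mem_nhds (show |lam 0| < |lam 0| + 1 by linarith))
    filter_upwards [this] with ε hε
    refine LipschitzOnWith.of_dist_le_mul fun x _ y _ => ?_
    rw [Real.coe_toNNReal _ (by positivity), Real.dist_eq, Real.dist_eq, ← mul_sub, abs_mul]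
    exact mul_le_mul_of_nonneg_right hε.le (abs_nonneg _)
  have hz := ODE_solution_unique_of_eventually (v := fun ε x => lam ε * x) (g := fun _ => 0)
    hbd hode
    (Filter.Eventually.of_forall fun ε => ⟨by simpa using hasDerivAt_const ε (0 : ℝ), trivial⟩)
    (by simp only [hc0]; exact (hzero.1 hon).2)
  filter_upwards [hz, hsrc, hjD] with ε hε hεs hεD g hg
  have hcp : c ε = pt ε (movedPt Φ ε f s) := movedMap_pt Φ f ε s
  have hm := hcm hεs
  rw [hcp] at hε hεD hm
  exact (h.onEquation_iff hm (C.eventuallyEq_of_transform hεs hg.2)).2 ⟨hεD, hε⟩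

/-- A symmetry group makes the derivative of the defect vanish on the equation. -/
lemma IsSymmetryGroup.exists_defectVel_eq_zero (hsym : IsSymmetryGroup D F G Φ)
    (hD : IsOpen D) (hF : ContDiffOn ℝ ∞ F D) (hG : ContDiffOn ℝ ∞ G D)
    (hM : IsOpen M) (hDM : ∀ q ∈ D, base q ∈ M)
    (hτ : ContDiffOn ℝ ∞ τ M) (hξ : ContDiffOn ℝ ∞ ξ M) (hη : ContDiffOn ℝ ∞ η M)
    (hΦ : IsGenerator Φ τ ξ η) (hf : ContDiff ℝ ∞ f) (hon : OnEquation D F G f s) :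
    ∃ v, defectVel F G τ ξ η v (pt 0 s) = 0 ∧ defect F G v (pt 0 s) = 0 ∧
      vjet v (pt 0 s) = jet f s ∧
      (∀ k ≤ 4, vx v k (pt 0 s) = (pd 1)^[k] f s) ∧
      ∀ k ≤ 4, vtx v k (pt 0 s) = pd 0 ((pd 1)^[k] f) s := by
  have hs : graphPt f s ∈ M := hDM _ hon.1
  -- A chart of order `∞` is needed here: invariance speaks of smooth transforms only, so the slices
  -- of the moved graphs must be smooth to qualify.
  obtain ⟨C⟩ := exists_flowChart (Φ := Φ) hM (n := ∞) (by exact_mod_cast le_top) le_rfl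
    isOpen_univ (Set.mem_univ s) hf.contDiffOn hs
  have h := C.isMovedBy hM hτ hξ hη hΦ six_le_infty
  have hc0 : movedMap Φ f (pt 0 s) = pt 0 s := by rw [movedMap_pt, movedPt_zero hs]
  have hm : pt 0 s ∈ C.chart.target := hc0 ▸ C.movedMap_mem C.mem_source
  have hsl := C.eventuallyEq_zero hM hf.continuous.continuousAt hs
  obtain ⟨hj, hd⟩ := (h.onEquation_iff hm hsl).1 hon
  refine ⟨C.moved, ?_, hd, (h.jet_slice hm hsl).symm,
    fun k hk => (h.iterate_pd_slice_eq hm hsl (by omega)).symm,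
    fun k hk => (h.pd_zero_iterate_pd_slice hm hsl (by omega)).symm⟩
  have hc := C.hasDerivAt_movedMap hΦ C.mem_source
  have h1 := h.hasDerivAt_defect (F := F) (G := G) (c := fun e => movedMap Φ f (pt e s)) (e := 0)
    (C.movedMap_mem C.mem_source) hc
    (by simp only [hc0]; exact (hF.contDiffAt (hD.mem_nhds hj)).differentiableAt (by simp))
    (by simp only [hc0]; exact (hG.contDiffAt (hD.mem_nhds hj)).differentiableAt (by simp))
  simp only [hc0] at h1
  -- By invariance the defect along the orbit is 0 for all small `ε`.
  refine h1.unique ((hasDerivAt_const (0 : ℝ) (0 : ℝ)).congr_of_eventuallyEq ?_)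
  filter_upwards [hsym f s hf.contDiffAt hon, C.eventually_mem_source] with ε hε hεs
  have hmε := C.movedMap_mem hεs
  rw [movedMap_pt] at hmε ⊢
  exact ((h.onEquation_iff hmε Filter.EventuallyEq.rfl).1 (hε _ (C.isTransform hεs))).2

end Flow

/-! ### Functions with prescribed jets -/

/-- The polynomial `∑ (aₖ + bₖ T) Xᵏ / k!` in `T = t - t₀`, `X = x - x₀`. -/
noncomputable def jetPoly (r : Fin 2 → ℝ) (a0 a1 a2 a3 a4 b0 b1 b2 b3 : ℝ) (s : Fin 2 → ℝ) : ℝ :=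
  a0 + a1 * (s 1 - r 1) + a2 / 2 * (s 1 - r 1) ^ 2 + a3 / 6 * (s 1 - r 1) ^ 3
    + a4 / 24 * (s 1 - r 1) ^ 4
    + (s 0 - r 0) * (b0 + b1 * (s 1 - r 1) + b2 / 2 * (s 1 - r 1) ^ 2 + b3 / 6 * (s 1 - r 1) ^ 3)

section JetPoly

variable (r : Fin 2 → ℝ) (a0 a1 a2 a3 a4 b0 b1 b2 b3 : ℝ)

lemma contDiff_jetPoly : ContDiff ℝ ∞ (jetPoly r a0 a1 a2 a3 a4 b0 b1 b2 b3) := by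
  unfold jetPoly
  fun_prop

lemma jetPoly_self : jetPoly r a0 a1 a2 a3 a4 b0 b1 b2 b3 r = a0 := by
  simp [jetPoly]

lemma hasPdOn_jetPoly (i : Fin 2) (s : Fin 2 → ℝ) :
    pd i (jetPoly r a0 a1 a2 a3 a4 b0 b1 b2 b3) s =
      (Pi.single i 1 : Fin 2 → ℝ) 1 * jetPoly r a1 a2 a3 a4 0 b1 b2 b3 0 s
      + (Pi.single i 1 : Fin 2 → ℝ) 0 *
        (b0 + b1 * (s 1 - r 1) + b2 / 2 * (s 1 - r 1) ^ 2 + b3 / 6 * (s 1 - r 1) ^ 3) := by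
  have K : ∀ c : ℝ, HasPdOn i (Set.univ : Set (Fin 2 → ℝ)) (fun _ => c) (fun _ => 0) :=
    fun c => HasPdOn.const c
  have X := (HasPdOn.coord (i := i) (Ω := Set.univ) (1 : Fin 2)).sub (K (r 1))
  have T := (HasPdOn.coord (i := i) (Ω := Set.univ) (0 : Fin 2)).sub (K (r 0))
  have h := (((((K a0).add (X.const_mul a1)).add ((X.pow 1).const_mul (a2 / 2))).add
    ((X.pow 2).const_mul (a3 / 6))).add ((X.pow 3).const_mul (a4 / 24))).add
    (T.mul ((((K b0).add (X.const_mul b1)).add ((X.pow 1).const_mul (b2 / 2))).add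
      ((X.pow 2).const_mul (b3 / 6))))
  refine (h s trivial).2.trans ?_
  simp only [jetPoly]
  push_cast
  ring

/-- The family is closed under `∂_x`, which shifts both rows of coefficients. Iterating reads off
all the required derivatives at `r`. -/
lemma pd_one_jetPoly : pd 1 (jetPoly r a0 a1 a2 a3 a4 b0 b1 b2 b3)
    = jetPoly r a1 a2 a3 a4 0 b1 b2 b3 0 := by
  ext s
  rw [hasPdOn_jetPoly]
  simp

lemma pd_zero_jetPoly_self : pd 0 (jetPoly r a0 a1 a2 a3 a4 b0 b1 b2 b3) r = b0 := by
  rw [hasPdOn_jetPoly]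
  simp

end JetPoly

/-! ### Necessity of the classifying equations -/

section Necessity

variable {M : Set (Fin 3 → ℝ)} {Φ : LocalGroup M} {τ ξ η : (Fin 3 → ℝ) → ℝ}
  {D : Set (Fin 6 → ℝ)} {F G : (Fin 6 → ℝ) → ℝ}

lemma isOpenMap_base : IsOpenMap base := by
  have h : base = LinearMap.funLeft ℝ ℝ (Fin.castLE (by norm_num : 3 ≤ 6)) := by
    ext q i
    fin_cases i <;> rfl
  rw [h]
  exact (LinearMap.funLeft ℝ ℝ _).isOpenMap_of_finiteDimensional
    (LinearMap.funLeft_surjective_of_injective ℝ ℝ _ (Fin.castLE_injective _))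

/-- The jets on the equation at which a symmetry group has to preserve it. -/
lemma IsSymmetryGroup.exists_of_jet (hsym : IsSymmetryGroup D F G Φ)
    (hD : IsOpen D) (hF : ContDiffOn ℝ ∞ F D) (hG : ContDiffOn ℝ ∞ G D)
    (hM : IsOpen M) (hDM : ∀ q ∈ D, base q ∈ M)
    (hτ : ContDiffOn ℝ ∞ τ M) (hξ : ContDiffOn ℝ ∞ ξ M) (hη : ContDiffOn ℝ ∞ η M)
    (hΦ : IsGenerator Φ τ ξ η) {q : Fin 6 → ℝ} (hq : q ∈ D) (u4 w : ℝ) :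
    ∃ v z, defectVel F G τ ξ η v z = 0 ∧ defect F G v z = 0 ∧ vjet v z = q ∧
      vx v 4 z = u4 ∧ vtx v 0 z = F q * u4 + G q ∧ vtx v 1 z = 0 ∧ vtx v 2 z = 0 ∧
      vtx v 3 z = w := by
  set r : Fin 2 → ℝ := ![q 0, q 1] with hr
  -- The jet `q` fixes the `x`-derivatives below order four and the equation fixes `u_t`. Of the
  -- rest, `u_xxxx = u4` and `u_txxx = w` stay free, while `u_tx` and `u_txx` are set to 0.
  set f := jetPoly r (q 2) (q 3) (q 4) (q 5) u4 (F q * u4 + G q) 0 0 w with hf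
  have hjet : jet f r = q := by
    ext i
    fin_cases i <;> simp [jet, hf, pd_one_jetPoly, jetPoly_self, hr]
  have hon : OnEquation D F G f r := by
    unfold OnEquation
    rw [hjet]
    refine ⟨hq, ?_⟩
    simp only [hf, pd_one_jetPoly, jetPoly_self, pd_zero_jetPoly_self]
  obtain ⟨v, h1, h2, h3, h4, h5⟩ := hsym.exists_defectVel_eq_zero hD hF hG hM hDM hτ hξ hη hΦ
    (contDiff_jetPoly r _ _ _ _ _ _ _ _ _) hon
  refine ⟨v, pt 0 r, h1, h2, h3.trans hjet, ?_, ?_, ?_, ?_, ?_⟩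
  · simp [h4 4, pd_one_jetPoly, jetPoly_self]
  · simp [h5 0, pd_zero_jetPoly_self]
  · simp [h5 1, pd_one_jetPoly, pd_zero_jetPoly_self]
  · simp [h5 2, pd_one_jetPoly, pd_zero_jetPoly_self]
  · simp [h5 3, pd_one_jetPoly, pd_zero_jetPoly_self]

/-- Only the `∂_{u_xxxx}`-component contains `u_txxx`, so `defectVel` is affine in it with slope `4
F (τ_x + u_x τ_u)`. Comparing the values 0 and 1 of `u_txxx` at otherwise equal jets isolates the
slope. -/
lemma IsSymmetryGroup.total1_eq_zero (hsym : IsSymmetryGroup D F G Φ)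
    (hD : IsOpen D) (hF : ContDiffOn ℝ ∞ F D) (hG : ContDiffOn ℝ ∞ G D) (hF0 : ∀ q ∈ D, F q ≠ 0)
    (hM : IsOpen M) (hDM : ∀ q ∈ D, base q ∈ M)
    (hτ : ContDiffOn ℝ ∞ τ M) (hξ : ContDiffOn ℝ ∞ ξ M) (hη : ContDiffOn ℝ ∞ η M)
    (hΦ : IsGenerator Φ τ ξ η) {q : Fin 6 → ℝ} (hq : q ∈ D) : total1 τ (base q) (q 3) = 0 := by
  have key : ∀ w : ℝ, ∃ v z, defectVel F G τ ξ η v z = 0 ∧ vjet v z = q ∧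
      vx v 4 z = 0 ∧ vtx v 0 z = G q ∧ vtx v 1 z = 0 ∧ vtx v 2 z = 0 ∧ vtx v 3 z = w ∧
      lift v z = base q ∧ vx v 1 z = q 3 ∧ vx v 2 z = q 4 ∧ vx v 3 z = q 5 := fun w => by
    obtain ⟨v, z, h1, -, h3, h4, h5, h6, h7, h8⟩ :=
      hsym.exists_of_jet hD hF hG hM hDM hτ hξ hη hΦ hq 0 w
    refine ⟨v, z, h1, h3, h4, by simpa using h5, h6, h7, h8, ?_, congrFun h3 3, congrFun h3 4,
      congrFun h3 5⟩
    rw [← base_vjet, h3]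
  obtain ⟨v, z, h1, h2, h3, h4, h5, h6, h7, h8, h9, h10, h11⟩ := key 0
  obtain ⟨v', z', k1, k2, k3, k4, k5, k6, k7, k8, k9, k10, k11⟩ := key 1
  simp only [defectVel, vjetVel, prolT, prol1, prol2, prol3, prol4, h2, h3, h4, h5, h6, h7, h8, h9,
    h10, h11] at h1
  simp only [defectVel, vjetVel, prolT, prol1, prol2, prol3, prol4, k2, k3, k4, k5, k6, k7, k8, k9,
    k10, k11] at k1
  have : 4 * F q * total1 τ (base q) (q 3) = 0 := by linear_combination k1 - h1
  simpa [hF0 q hq] using this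

/-- The relation `τ_x + u_x τ_u = 0` holds for two values of `u_x` over the same base point, because
`D` is open. -/
lemma IsSymmetryGroup.pd_tau_eq_zero (hsym : IsSymmetryGroup D F G Φ)
    (hD : IsOpen D) (hF : ContDiffOn ℝ ∞ F D) (hG : ContDiffOn ℝ ∞ G D) (hF0 : ∀ q ∈ D, F q ≠ 0)
    (hM : IsOpen M) (hDM : ∀ q ∈ D, base q ∈ M)
    (hτ : ContDiffOn ℝ ∞ τ M) (hξ : ContDiffOn ℝ ∞ ξ M) (hη : ContDiffOn ℝ ∞ η M)
    (hΦ : IsGenerator Φ τ ξ η) {q : Fin 6 → ℝ} (hq : q ∈ D) :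
    pd 1 τ (base q) = 0 ∧ pd 2 τ (base q) = 0 := by
  have key : ∀ q ∈ D, total1 τ (base q) (q 3) = 0 := fun q hq =>
    hsym.total1_eq_zero hD hF hG hF0 hM hDM hτ hξ hη hΦ hq
  have hc : ContinuousAt (fun δ : ℝ => q + δ • (Pi.single 3 1 : Fin 6 → ℝ)) 0 := by fun_prop
  have hev : ∀ᶠ δ : ℝ in 𝓝[≠] 0, q + δ • (Pi.single 3 1 : Fin 6 → ℝ) ∈ D :=
    (hc.eventually (by simpa using hD.mem_nhds hq)).filter_mono nhdsWithin_le_nhds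
  obtain ⟨δ, hδ, hδ0⟩ := (hev.and self_mem_nhdsWithin).exists
  have h1 := key q hq
  have h2 := key _ hδ
  have hb : base (q + δ • (Pi.single 3 1 : Fin 6 → ℝ)) = base q := by
    ext i
    fin_cases i <;> simp [base]
  have h3 : (q + δ • (Pi.single 3 1 : Fin 6 → ℝ)) 3 = q 3 + δ := by simp
  rw [hb, h3] at h2
  simp only [total1] at h1 h2
  have h4 : pd 2 τ (base q) = 0 := by
    have : δ * pd 2 τ (base q) = 0 := by linear_combination h2 - h1
    exact (mul_eq_zero.1 this).resolve_left hδ0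
  exact ⟨by simpa [h4] using h1, h4⟩

/-- A function on `M` without derivatives in the directions `x`, `u` depends on `t` only if the
slices of `M` are connected. -/
lemma exists_base_of_pd_eq_zero (hM : IsOpen M) (hτ : ContDiffOn ℝ ∞ τ M)
    (hslice : ∀ t : ℝ, IsPreconnected {p : Fin 3 → ℝ | p ∈ M ∧ p 0 = t})
    (h : ∀ p ∈ M, pd 1 τ p = 0 ∧ pd 2 τ p = 0) : ∃ τ₀ : ℝ → ℝ, ∀ p ∈ M, τ p = τ₀ (p 0) := by
  have key : ∀ p ∈ M, ∀ p' ∈ M, p 0 = p' 0 → τ p = τ p' := by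
    intro p hp p' hp' hpp
    set t := p 0 with ht
    have hd : ∀ r, pt t r ∈ M → DifferentiableAt ℝ τ (pt t r) := fun r hr =>
      (hτ.contDiffAt (hM.mem_nhds hr)).differentiableAt (by simp)
    -- The slice is viewed as an open connected subset of the `(x, u)`-plane, on which a function
    -- with zero derivative is constant.
    have hS : IsOpen (pt t ⁻¹' M) := hM.preimage (contDiff_pt t).continuous
    have hSc : IsPreconnected (pt t ⁻¹' M) := by
      have : pt t ⁻¹' M = tl '' {p : Fin 3 → ℝ | p ∈ M ∧ p 0 = t} := by
        ext r
        constructor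
        · intro hr
          exact ⟨pt t r, ⟨hr, rfl⟩, tl_pt t r⟩
        · rintro ⟨p, ⟨hp, hpt⟩, rfl⟩
          rw [Set.mem_preimage, ← hpt, pt_tl]
          exact hp
      rw [this]
      exact (hslice t).image _ contDiff_tl.continuous.continuousOn
    have hconst := hS.is_const_of_fderiv_eq_zero (𝕜 := ℝ) (f := fun r => τ (pt t r)) hSc
      (fun r hr => ((hd r hr).comp r
        ((contDiff_pt t).differentiable (by simp) r)).differentiableWithinAt)
      (fun r hr => by
        ext1 w
        rw [fderiv_eq_sum_pd, Fin.sum_univ_two, pd_comp_pt 0 (hd r hr), pd_comp_pt 1 (hd r hr)]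
        have := h _ hr
        simp [this.1, this.2])
      (x := tl p) (y := tl p') (by rw [Set.mem_preimage, ht, pt_tl]; exact hp)
      (by rw [Set.mem_preimage, hpp, pt_tl]; exact hp')
    rwa [ht, pt_tl, ← ht, hpp, pt_tl] at hconst
  classical
  -- Any point of the slice may define the value; the 0 over empty slices is never used.
  refine ⟨fun t => if ht : ∃ p ∈ M, p 0 = t then τ ht.choose else 0, fun p hp => ?_⟩
  have ht : ∃ p' ∈ M, p' 0 = p 0 := ⟨p, hp, rfl⟩
  simp only [dif_pos ht]
  exact key p hp _ ht.choose_spec.1 ht.choose_spec.2.symm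

/-- The classifying equations are necessary. -/
lemma IsSymmetryGroup.class_of_base (hsym : IsSymmetryGroup D F G Φ)
    (hD : IsOpen D) (hF : ContDiffOn ℝ ∞ F D) (hG : ContDiffOn ℝ ∞ G D)
    (hM : IsOpen M) (hDM : ∀ q ∈ D, base q ∈ M)
    (hτ : ContDiffOn ℝ ∞ τ M) (hξ : ContDiffOn ℝ ∞ ξ M) (hη : ContDiffOn ℝ ∞ η M)
    (hΦ : IsGenerator Φ τ ξ η) {τ₀ : ℝ → ℝ} (h0 : ∀ p ∈ M, τ p = τ₀ (p 0))
    {q : Fin 6 → ℝ} (hq : q ∈ D) : Class1 F τ₀ ξ η q ∧ Class2 F G τ₀ ξ η q := by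
  have key : ∀ u4 : ℝ, ∃ v z, defectVel F G τ ξ η v z = 0 ∧ defect F G v z = 0 ∧ vjet v z = q ∧
      vx v 4 z = u4 ∧ lift v z = base q ∧ vx v 1 z = q 3 ∧ z 1 = q 0 := fun u4 => by
    obtain ⟨v, z, h1, h2, h3, h4, -⟩ := hsym.exists_of_jet hD hF hG hM hDM hτ hξ hη hΦ hq u4 0
    exact ⟨v, z, h1, h2, h3, h4, by rw [← base_vjet, h3], congrFun h3 3, congrFun h3 0⟩
  -- On the equation the derivative of the defect is `u_xxxx C₁ + C₂`, with `C₁`, `C₂` depending on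
  -- `q` only. The value `u_xxxx = 0` gives the second classifying equation, and `u_xxxx = 1` then
  -- the first.
  obtain ⟨v, z, h1, h2, h3, h4, h5, h6, h7⟩ := key 0
  obtain ⟨v', z', k1, k2, k3, k4, k5, k6, k7⟩ := key 1
  have e0 := defectVel_eq (F := F) (G := G) (ξ := ξ) (η := η) hM hτ h0
    (h5 ▸ hDM q hq : lift v z ∈ M)
  have e1 := defectVel_eq (F := F) (G := G) (ξ := ξ) (η := η) hM hτ h0
    (k5 ▸ hDM q hq : lift v' z' ∈ M)
  rw [h1, h2, h3, h4, h5, h6, h7, mul_zero, zero_add, zero_mul, zero_add] at e0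
  rw [k1, k2, k3, k4, k5, k6, k7, mul_zero, zero_add, ← e0, add_zero, one_mul] at e1
  exact ⟨e1.symm, e0.symm⟩

end Necessity

end FourthOrder

theorem proposition1
    (D : Set (Fin 6 → ℝ)) (hD : IsOpen D)
    (F G : (Fin 6 → ℝ) → ℝ) (hF : ContDiffOn ℝ ∞ F D) (hG : ContDiffOn ℝ ∞ G D)
    (hF0 : ∀ q ∈ D, F q ≠ 0)
    (M : Set (Fin 3 → ℝ)) (hM : M = base '' D)
    (hslice : ∀ t : ℝ, IsPreconnected {p : Fin 3 → ℝ | p ∈ M ∧ p 0 = t})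
    (τ ξ η : (Fin 3 → ℝ) → ℝ)
    (hτ : ContDiffOn ℝ ∞ τ M) (hξ : ContDiffOn ℝ ∞ ξ M) (hη : ContDiffOn ℝ ∞ η M)
    (Φ : LocalGroup M) (hΦ : IsGenerator Φ τ ξ η) :
    IsSymmetryGroup D F G Φ ↔
      ∃ τ₀ : ℝ → ℝ, (∀ p ∈ M, τ p = τ₀ (p 0)) ∧
        ∀ q ∈ D, Class1 F τ₀ ξ η q ∧ Class2 F G τ₀ ξ η q := by
  have hMo : IsOpen M := by
    rw [hM]
    exact isOpenMap_base D hD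
  have hDM : ∀ q ∈ D, base q ∈ M := fun q hq => by
    rw [hM]
    exact Set.mem_image_of_mem base hq
  constructor
  · intro hsym
    have hpd : ∀ p ∈ M, pd 1 τ p = 0 ∧ pd 2 τ p = 0 := by
      intro p hp
      rw [hM] at hp
      obtain ⟨q, hq, rfl⟩ := hp
      exact hsym.pd_tau_eq_zero hD hF hG hF0 hMo hDM hτ hξ hη hΦ hq
    obtain ⟨τ₀, h0⟩ := exists_base_of_pd_eq_zero hMo hτ hslice hpd
    exact ⟨τ₀, h0, fun q hq => hsym.class_of_base hD hF hG hMo hDM hτ hξ hη hΦ h0 hq⟩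
  · rintro ⟨τ₀, h0, hcl⟩
    exact isSymmetryGroup_of_class hD hF hG hMo hDM hτ hξ hη hΦ h0 hcl
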